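/- Fix an integer $r\ge 1$. For $g\ge 0$, $n\ge 1$ and $\vec\mu=(\mu_1,\dots,\mu_n)\in\mathbb{Z}_+^n$ let $H_{g,n}^{(r)}(\vec\mu)$ be the orbifold Hurwitz number: the automorphism-weighted count of connected branched coverings of $\mathbb{P}^1$ by curves of genus $g$ with $n$ labelled poles of orders $\mu_1,\dots,\mu_n$, all zeros unlabelled and of order exactly $r$, and $s=2g-2+n+(\mu_1+\cdots+\mu_n)/r$ further unlabelled simple branch points. In terms of monodromy, with $d=\mu_1+\cdots+\mu_n$, it is $\frac{1}{d!\,s!}$ times the number of tuples consisting of a permutation $\alpha\in\mathfrak S_d$ all of whose cycles have length $r$, transpositions $\tau_1,\dots,\tau_s\in\mathfrak S_d$, and a labelling by $1,\dots,n$ of the cycles of $\alpha\tau_1\cdots\tau_s$ such that the $i$-th cycle has length $\mu_i$, where $\alpha,\tau_1,\dots,\tau_s$ generate a transitive subgroup. Put $$F_{g,n}^{(r)}(z_1,\dots,z_n)=\sum_{\vec\mu\in\mathbb{Z}_+^n}H_{g,n}^{(r)}(\vec\mu)\prod_{i=1}^n x_i^{\mu_i},\qquad x_i=z_ie^{-z_i^r},$$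 a formal power series in $z_1,\dots,z_n$, and define the partition function $$Z^{(r)}(z,\hbar)=\exp\Big(\sum_{g\ge 0}\sum_{n\ge 1}\frac{1}{n!}\hbar^{2g-2+n}F_{g,n}^{(r)}(z,\dots,z)\Big)\in\mathbb{C}((\hbar))[[z]].$$ Let $x=e^{-w}=ze^{-z^r}$ and $D=\frac{z}{1-rz^r}\frac{\partial}{\partial z}$, and consider the operators $$P=\hbar D-e^{r(-w+\frac{r-1}{2}\hbar)}e^{r\hbar D},\qquad Q=\frac{\hbar}{2}D^2-\Big(\frac1r+\frac{\hbar}{2}\Big)D-\hbar\frac{\partial}{\partial\hbar}$$ on $\mathbb{C}((\hbar))[[z]]$, where $e^{r\hbar D}=\sum_k (r\hbar D)^k/k!$. Then: 1. $P\,Z^{(r)}=0$ and $Q\,Z^{(r)}=0$; moreover $D=x\frac{\partial}{\partial x}$. 2. $[P,Q]=PQ-QP=P$. 3. The semi-classical limit of each of the two equations recovers the $r$-Lambert curve. Precisely, for every $\Psi=\exp\big(\sum_{m\ge 0}\hbar^{m-1}S_m(z)\big)$ with $S_m\in z\mathbb{C}[[z]]$, and with $y=DS_0$, $$\Psi^{-1}P\Psi=\big(y-x^re^{ry}\big)+O(\hbar),\qquad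 \Psi^{-1}Q\Psi=\hbar^{-1}\Big(\tfrac12y^2-\tfrac1r y+S_0+O(\hbar)\Big).$$ For $S_0\in z\mathbb{C}[[z]]$ and $y=DS_0$, the equation $y-x^re^{ry}=0$ holds if and only if $x^r=ye^{-ry}$. The equation $\tfrac12y^2-\tfrac1ry+S_0=0$ holds if and only if $c\,x^r=ye^{-ry}$ for some constant $c\in\mathbb{C}$; and it holds with the coefficient of $z^r$ in $S_0$ equal to $\frac1r$ if and only if $x^r=ye^{-ry}$. For $\Psi=Z^{(r)}$ one has $S_0=F_{0,1}^{(r)}(z)$, a series without constant term whose coefficient of $z^r$ is $\frac1r$, and $y=DF_{0,1}^{(r)}=z^r$, which is the only $y\in z\mathbb{C}[[z]]$ with $x^r=ye^{-ry}$; thus the curve is $x=ze^{-z^r}$, $y=z^r$. -/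

import Mathlib

namespace OrbifoldHurwitz

noncomputable section

/-! ### Orbifold Hurwitz numbers -/

/-- Monodromy data of a connected branched covering of the sphere of degree `d`:
`α` is the monodromy around `0`, all of whose cycles have length `r`; the `τ i` are the
transpositions at the `s` simple branch points; `ℓ` labels the cycles of the monodromy at `∞`
(that is, the poles) by `Fin n`, the `i`-th cycle having length `μ i`.
The covering is connected: the monodromy group is transitive on the sheets. -/
structure IsMonodromy (r : ℕ) {n d s : ℕ} (μ : Fin n → ℕ)
    (α : Equiv.Perm (Fin d)) (τ : Fin s → Equiv.Perm (Fin d)) (ℓ : Fin d → Fin n) : Prop where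
  zeros : ∀ x, Function.minimalPeriod α x = r
  simple : ∀ i, (τ i).IsSwap
  poles : ∀ x y, ℓ x = ℓ y ↔ (α * (List.ofFn τ).prod).SameCycle x y
  orders : ∀ i, Nat.card {x // ℓ x = i} = μ i
  connected : MulAction.IsPretransitive
    (Subgroup.closure (insert α (Set.range τ))) (Fin d)

/-- The number of simple branch points given by the Riemann-Hurwitz formula,
`s = 2g - 2 + n + (μ₁ + ⋯ + μₙ) / r`. (It is nonnegative as soon as `n ≥ 1` and there is at
least one zero; when `r` does not divide `μ₁ + ⋯ + μₙ` there are no coverings at all.) -/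
def simpleBranchPoints (r g : ℕ) {n : ℕ} (μ : Fin n → ℕ) : ℕ :=
  2 * g + n + (∑ i, μ i) / r - 2

/-- The orbifold Hurwitz number `H_{g,n}^{(r)}(μ₁, …, μₙ)`: the number of connected genus `g`
coverings with `n` labelled poles of orders `μ`, all zeros of order `r` (unlabelled), and
otherwise simply ramified, each weighted by the inverse order of its automorphism group. Dividing
the number of monodromy data by `d!` gives the weighted count of isomorphism classes for ordered
simple branch points; the factor `1 / s!` is there because the simple branch points are
not labelled. -/
def hurwitz (r g : ℕ) {n : ℕ} (μ : Fin n → ℕ) : ℚ :=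
  (Nat.card {c : Equiv.Perm (Fin (∑ i, μ i)) ×
      (Fin (simpleBranchPoints r g μ) → Equiv.Perm (Fin (∑ i, μ i))) ×
      (Fin (∑ i, μ i) → Fin n) // IsMonodromy r μ c.1 c.2.1 c.2.2} : ℚ) /
    ((∑ i, μ i).factorial * (simpleBranchPoints r g μ).factorial)

/-! ### Free energies -/

/-- The composition `exp(f)` for a formal power series `f` without constant term. -/
def fexp {K : Type*} [CommRing K] [Algebra ℚ K] (f : PowerSeries K) : PowerSeries K :=
  PowerSeries.subst f (PowerSeries.exp K)

/-- The `r`-Lambert function `x = e^{-w} = z e^{-z^r}`, as a power series in `z`. -/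
def lambertX (r : ℕ) : PowerSeries ℂ :=
  PowerSeries.X * fexp (-(PowerSeries.X ^ r))

/-- The free energy `F_{g,n}[x₁, …, xₙ] = ∑_{μ ∈ ℤ₊ⁿ} H_{g,n}(μ) ∏ xᵢ^{μᵢ}`. -/
def freeEnergyX (r g n : ℕ) : MvPowerSeries (Fin n) ℂ :=
  fun μ => if ∀ i, 0 < μ i then (hurwitz r g μ : ℂ) else 0

/-- The free energy `F_{g,n}(z₁, …, zₙ)`, obtained by `xᵢ = zᵢ e^{-zᵢ^r}`. -/
def freeEnergy (r g n : ℕ) : MvPowerSeries (Fin n) ℂ :=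
  MvPowerSeries.subst
    (fun i => PowerSeries.subst (MvPowerSeries.X i : MvPowerSeries (Fin n) ℂ) (lambertX r))
    (freeEnergyX r g n)

/-- The principal specialization `F_{g,n}(z, …, z)`. -/
def freeEnergyDiag (r g n : ℕ) : PowerSeries ℂ :=
  MvPowerSeries.subst (fun _ : Fin n => (PowerSeries.X : PowerSeries ℂ)) (freeEnergy r g n)

/-- `S_m(z) = ∑ F_{g,n}(z, …, z) / n!` over all `g ≥ 0`, `n ≥ 1` with `2g - 2 + n = m - 1`:
the coefficient of `ħ^{m-1}` in `∑_{g ≥ 0, n ≥ 1} ħ^{2g-2+n} F_{g,n}(z, …, z) / n!`. -/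
def freeEnergyS (r m : ℕ) : PowerSeries ℂ :=
  ∑ p ∈ (Finset.range (m + 2) ×ˢ Finset.Icc 1 (m + 1)).filter (fun p => 2 * p.1 + p.2 = m + 1),
    ((p.2.factorial : ℂ)⁻¹) • freeEnergyDiag r p.1 p.2

/-! ### Formal series in `z` whose coefficients are Laurent series in `ħ` -/

/-- `ℂ((ħ))[[z]]`. -/
abbrev Fun : Type := PowerSeries (LaurentSeries ℂ)

/-- Power series in `z` as series in `z` and `ħ` that are constant in `ħ`. -/
def emb : PowerSeries ℂ →+* Fun := PowerSeries.map HahnSeries.C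

/-- `ħ`. -/
def hbar : LaurentSeries ℂ := HahnSeries.single 1 1

/-- `e^{cħ}`. -/
def expHbar (c : ℂ) : LaurentSeries ℂ :=
  HahnSeries.ofPowerSeries ℤ ℂ (PowerSeries.rescale c (PowerSeries.exp ℂ))

/-- `∑_{m ≥ 0} ħ^{m-1} S_m(z)`. -/
def phase (S : ℕ → PowerSeries ℂ) : Fun :=
  PowerSeries.mk fun d => HahnSeries.single (-1 : ℤ) (1 : ℂ) *
    HahnSeries.ofPowerSeries ℤ ℂ (PowerSeries.mk fun m => PowerSeries.coeff d (S m))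

/-- The partition function
`Z(z, ħ) = exp(∑_{g ≥ 0} ∑_{n ≥ 1} ħ^{2g-2+n} F_{g,n}(z, …, z) / n!)`. -/
def partitionFunction (r : ℕ) : Fun := fexp (phase (freeEnergyS r))

/-! ### Operators -/

/-- `D = z / (1 - r z^r) ∂/∂z`, on power series in `z` over a field `K`. -/
def opD (r : ℕ) (K : Type*) [Field K] : AddMonoid.End (PowerSeries K) :=
  (AddMonoidHom.mulLeft
      (PowerSeries.X * (1 - PowerSeries.C (r : K) * PowerSeries.X ^ r)⁻¹)).comp
    (PowerSeries.derivative K).toLinearMap.toAddMonoidHom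

/-- Multiplication by an element of `ℂ((ħ))[[z]]`. -/
def mulOp (a : Fun) : AddMonoid.End Fun := AddMonoidHom.mulLeft a

/-- `∂/∂ħ`. -/
def dHbar : AddMonoid.End Fun where
  toFun f := PowerSeries.mk fun d => LaurentSeries.derivative ℂ (PowerSeries.coeff d f)
  map_zero' := by ext1 d; simp
  map_add' f g := by ext1 d; simp

/-- The coefficients of `z^0, …, z^d` of `f` have no terms `ħ^j` with `j < N`. -/
def OrdGE (d : ℕ) (N : ℤ) (f : Fun) : Prop :=
  ∀ i ≤ d, ∀ j < N, (PowerSeries.coeff i f).coeff j = 0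

theorem exists_ordGE (d : ℕ) (f : Fun) : ∃ N, OrdGE d N f := by
  induction d with
  | zero =>
    refine ⟨(PowerSeries.coeff 0 f).order, fun i hi j hj => ?_⟩
    obtain rfl : i = 0 := by omega
    exact HahnSeries.coeff_eq_zero_of_lt_order hj
  | succ d ih =>
    obtain ⟨N, hN⟩ := ih
    refine ⟨min N (PowerSeries.coeff (d + 1) f).order, fun i hi j hj => ?_⟩
    rcases Nat.lt_or_ge d i with h | h
    · obtain rfl : i = d + 1 := by omega
      exact HahnSeries.coeff_eq_zero_of_lt_order (lt_of_lt_of_le hj (min_le_right _ _))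
    · exact hN i h j (lt_of_lt_of_le hj (min_le_left _ _))

theorem OrdGE.emb_mul {d : ℕ} {N : ℤ} {f : Fun} (h : OrdGE d N f) (u : PowerSeries ℂ) :
    OrdGE d N (emb u * f) := by
  intro i hi j hj
  rw [PowerSeries.coeff_mul, HahnSeries.coeff_sum]
  refine Finset.sum_eq_zero fun p hp => ?_
  rw [Finset.HasAntidiagonal.mem_antidiagonal] at hp
  rw [emb, PowerSeries.coeff_map, HahnSeries.C_mul_eq_smul, HahnSeries.coeff_smul,
    h p.2 (by omega) j hj, smul_zero]

theorem emb_inv (r : ℕ) :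
    emb (1 - PowerSeries.C (r : ℂ) * PowerSeries.X ^ r)⁻¹ =
      (1 - PowerSeries.C (r : LaurentSeries ℂ) * PowerSeries.X ^ r)⁻¹ := by
  have h0 (K : Type) [Field K] : PowerSeries.constantCoeff
      (1 - PowerSeries.C (r : K) * PowerSeries.X ^ r) ≠ 0 := by
    rcases Nat.eq_zero_or_pos r with rfl | h
    · simp
    · simp [h.ne']
  have he : emb (1 - PowerSeries.C (r : ℂ) * PowerSeries.X ^ r) =
      1 - PowerSeries.C (r : LaurentSeries ℂ) * PowerSeries.X ^ r := by
    simp [emb]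
  rw [PowerSeries.eq_inv_iff_mul_eq_one (h0 _), ← he, ← map_mul,
    PowerSeries.inv_mul_cancel _ (h0 _), map_one]

theorem opD_apply (r : ℕ) (f : Fun) : opD r (LaurentSeries ℂ) f =
    emb (1 - PowerSeries.C (r : ℂ) * PowerSeries.X ^ r)⁻¹ *
      (PowerSeries.X * PowerSeries.derivative (LaurentSeries ℂ) f) := by
  have h : opD r (LaurentSeries ℂ) f =
      (PowerSeries.X * (1 - PowerSeries.C (r : LaurentSeries ℂ) * PowerSeries.X ^ r)⁻¹) *
        PowerSeries.derivative (LaurentSeries ℂ) f := rfl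
  rw [h, emb_inv]
  ring

theorem OrdGE.opD_apply {r d : ℕ} {N : ℤ} {f : Fun} (h : OrdGE d N f) :
    OrdGE d N (opD r (LaurentSeries ℂ) f) := by
  rw [OrbifoldHurwitz.opD_apply]
  refine OrdGE.emb_mul (fun i hi j hj => ?_) _
  cases i with
  | zero => simp
  | succ i =>
    rw [PowerSeries.coeff_succ_X_mul, PowerSeries.coeff_derivative, mul_comm]
    have e : ((i : LaurentSeries ℂ) + 1) = HahnSeries.C ((i : ℂ) + 1) := by
      rw [map_add, map_one, map_natCast]
    rw [e, HahnSeries.C_mul_eq_smul, HahnSeries.coeff_smul, h (i + 1) hi j hj, smul_zero]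

theorem OrdGE.opD_iterate {r d : ℕ} {N : ℤ} {f : Fun} (h : OrdGE d N f) (k : ℕ) :
    OrdGE d N ((opD r (LaurentSeries ℂ))^[k] f) := by
  induction k with
  | zero => exact h
  | succ k ih => rw [Function.iterate_succ_apply']; exact OrdGE.opD_apply ih

/-- The coefficient of `z^d ħ^j` in the `k`-th term `(cħD)^k f / k!` of `e^{cħD} f`. -/
def expTerm (r : ℕ) (c : ℂ) (f : Fun) (d : ℕ) (j : ℤ) (k : ℕ) : ℂ :=
  c ^ k / k.factorial *
    (PowerSeries.coeff d ((opD r (LaurentSeries ℂ))^[k] f)).coeff (j - k)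

theorem expTerm_eq_zero {r : ℕ} {c : ℂ} {f : Fun} {d : ℕ} {N : ℤ} (h : OrdGE d N f)
    {j : ℤ} {k : ℕ} (hk : j - k < N) : expTerm r c f d j k = 0 := by
  rw [expTerm, h.opD_iterate k d le_rfl _ hk, mul_zero]

theorem expTerm_support_finite (r : ℕ) (c : ℂ) (f : Fun) (d : ℕ) (j : ℤ) :
    (Function.support (expTerm r c f d j)).Finite := by
  obtain ⟨N, hN⟩ := exists_ordGE d f
  refine (Set.finite_Iic (j - N).toNat).subset fun k hk => ?_
  by_contra hlt
  refine hk (expTerm_eq_zero hN ?_)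
  simp only [Set.mem_Iic, not_le] at hlt
  omega

theorem expTerm_bddBelow (r : ℕ) (c : ℂ) (f : Fun) (d : ℕ) :
    BddBelow (Function.support fun j => ∑ᶠ k, expTerm r c f d j k) := by
  obtain ⟨N, hN⟩ := exists_ordGE d f
  refine ⟨N, fun j hj => ?_⟩
  by_contra hlt
  refine hj ?_
  have : ∀ k, expTerm r c f d j k = 0 := fun k => expTerm_eq_zero hN (by omega)
  simp [this]

/-- The infinite order operator `e^{cħD} = ∑_k (cħD)^k / k!`. In the coefficient of each
`z^d ħ^j` only finitely many terms of the series are nonzero. -/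
def expOpD (r : ℕ) (c : ℂ) : AddMonoid.End Fun where
  toFun f := PowerSeries.mk fun d =>
    HahnSeries.ofSuppBddBelow (fun j => ∑ᶠ k, expTerm r c f d j k) (expTerm_bddBelow r c f d)
  map_zero' := by
    ext d j
    simp [expTerm]
  map_add' f g := by
    ext d j
    simp only [PowerSeries.coeff_mk, HahnSeries.coeff_ofSuppBddBelow, map_add,
      HahnSeries.coeff_add]
    rw [← finsum_add_distrib (expTerm_support_finite r c f d j)
      (expTerm_support_finite r c g d j)]
    refine finsum_congr fun k => ?_
    simp [expTerm, mul_add]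

/-- `P = ħD - e^{r(-w + (r-1)ħ/2)} e^{rħD}`, where `e^{-w} = x = z e^{-z^r}`. -/
def opP (r : ℕ) : AddMonoid.End Fun :=
  mulOp (PowerSeries.C hbar) * opD r (LaurentSeries ℂ) -
    mulOp (emb (lambertX r) ^ r * PowerSeries.C (expHbar ((r : ℂ) * ((r : ℂ) - 1) / 2))) *
      expOpD r (r : ℂ)

/-- `Q = (ħ/2) D² - (1/r + ħ/2) D - ħ ∂/∂ħ`. -/
def opQ (r : ℕ) : AddMonoid.End Fun :=
  mulOp (PowerSeries.C (HahnSeries.C (1 / 2 : ℂ) * hbar)) * opD r (LaurentSeries ℂ) ^ 2 -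
    mulOp (PowerSeries.C (HahnSeries.C (1 / (r : ℂ)) + HahnSeries.C (1 / 2 : ℂ) * hbar)) *
      opD r (LaurentSeries ℂ) -
    mulOp (PowerSeries.C hbar) * dHbar

/-! ### Semi-classical limit -/

/-- `G = ħ^k (L(z) + O(ħ))` as `ħ → 0`, coefficientwise in `z`. -/
def HasLeadingTerm (G : Fun) (k : ℤ) (L : PowerSeries ℂ) : Prop :=
  ∀ d, (∀ j < k, (PowerSeries.coeff d G).coeff j = 0) ∧
    (PowerSeries.coeff d G).coeff k = PowerSeries.coeff d L

/-- The semi-classical limit of the equation `T Ψ = 0`, of order `ħ^k`, is `L(S) = 0`: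
for every WKB wave function `Ψ = exp(∑_{m ≥ 0} ħ^{m-1} S_m(z))` one has
`Ψ⁻¹ T Ψ = ħ^k (L(S₀) + O(ħ))`. -/
def IsSemiclassicalLimit (T : AddMonoid.End Fun) (k : ℤ)
    (L : PowerSeries ℂ → PowerSeries ℂ) : Prop :=
  ∀ S : ℕ → PowerSeries ℂ, (∀ m, PowerSeries.constantCoeff (S m) = 0) →
    HasLeadingTerm (fexp (-phase S) * T (fexp (phase S))) k (L (S 0))

/-- The series `y(z)` parametrizes, together with `x = z e^{-z^r}`, the `r`-Lambert curve
`x^r = y e^{-ry}`. -/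
def OnLambertCurve (r : ℕ) (y : PowerSeries ℂ) : Prop :=
  lambertX r ^ r = y * fexp (-(PowerSeries.C (r : ℂ) * y))

end

end OrbifoldHurwitz

namespace OrbifoldHurwitz

noncomputable section

open PowerSeries

/-! ### Formal exponentials -/

section Exp

variable {K : Type*} [CommRing K]

/-! The proof passes to the variable $x=ze^{-z^r}$. As $x=z+\cdots$ is invertible under composition,
every series in $z$ is a series in $x$. There $D$ is $x\,d/dx$, multiplying $x^d$ by $d$, and
$e^{c\hbar D}$ is the rescaling $x\mapsto e^{c\hbar}x$ (`opD_subst`, `expOpD_subst`). Hence $Q$ is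
diagonal on powers of $x$ up to $\hbar\,\partial/\partial\hbar$, and $P$ is a diagonal term minus a
shift by $x^r$. The commutator is compared coefficient by coefficient (`opPX_opQX_sub`).

For the partition function, genus and poles need not be tracked separately. A connected covering has
$2g-2+n=s-d/r$, so the coefficient of $\hbar^{m-1}$ collects all connected coverings with
$s-d/r=m-1$, and the factor $1/n!$ forgets the labels. That each connected covering occurs for
exactly one pair with $g\ge0$, $n\ge1$ is the Riemann-Hurwitz inequality with its parity
(`cycleCount_add_le`, `sum_polesCount`). By the exponential formula, $Z$ counts all coverings,
connected or not (`mul_coverCount`, `fexp_phase_connectedSeries`). With no condition at infinity,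
$\alpha$ and the transpositions are chosen independently, so $$Z=\sum_m \frac{\hbar^{-m}}{r^m
m!}\,e^{\hbar\binom{rm}{2}}x^{rm}.$$ Then $PZ=0$ is the ratio of consecutive coefficients and $QZ=0$
is the logarithmic $\hbar$-derivative of each one (`opPX_partitionX`, `opQX_partitionX`).

For the semi-classical limits, $e^{c\hbar D}$ is a ring endomorphism, so conjugating it by
$e^\varphi$ gives $\exp(e^{c\hbar D}\varphi-\varphi)$, whose exponent is regular at $\hbar=0$ with
value $cDS_0$. Differentiating the limit of $Q$ turns it into $D(ye^{-ry})=r\,ye^{-ry}$, whose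
solutions have $ye^{-ry}$ a multiple of $x^r$ (`semiclassical_Q_iff`). Finally $DF_{0,1}=z^r$ needs
no evaluation of genus zero numbers: it follows from $PZ=0$, its limit, and uniqueness on the curve
(`onLambertCurve_iff`). -/

theorem isUnit_natCast_succ [Algebra ℚ K] (n : ℕ) : IsUnit ((n : K) + 1) := by
  have h : IsUnit ((n : ℚ) + 1) := isUnit_iff_ne_zero.mpr (by positivity)
  simpa using h.map (algebraMap ℚ K)

/-- A linear first order differential equation has at most one solution with a given
constant term. -/
theorem eq_of_derivative_eq_mul [Algebra ℚ K] {f g h : PowerSeries K}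
    (hf : derivative K f = h * f) (hg : derivative K g = h * g)
    (h0 : constantCoeff f = constantCoeff g) : f = g := by
  ext n
  induction n using Nat.strong_induction_on with
  | _ n ih =>
    cases n with
    | zero => simpa using h0
    | succ n =>
      have e1 := congrArg (coeff n) hf
      have e2 := congrArg (coeff n) hg
      rw [coeff_derivative, coeff_mul] at e1 e2
      refine (isUnit_natCast_succ (K := K) n).mul_right_cancel ?_
      rw [e1, e2]
      refine Finset.sum_congr rfl fun p hp => ?_
      rw [Finset.HasAntidiagonal.mem_antidiagonal] at hp
      rw [ih p.2 (by omega)]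

theorem constantCoeff_subst_eq_zero' {a f : PowerSeries K} (ha : constantCoeff a = 0)
    (hf : constantCoeff f = 0) : constantCoeff (f.subst a) = 0 :=
  PowerSeries.constantCoeff_subst_eq_zero (a := a) ha f hf

theorem constantCoeff_subst_of_zero {a : PowerSeries K} (ha : constantCoeff a = 0)
    (f : PowerSeries K) : constantCoeff (f.subst a) = constantCoeff f := by
  have h := constantCoeff_subst_eq_zero' (f := f - C (constantCoeff f)) ha (by simp)
  have hs : HasSubst a := .of_constantCoeff_zero' ha
  rw [subst_sub hs, map_sub, sub_eq_zero] at h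
  rw [h]
  have : (C (constantCoeff f)).subst a = C (constantCoeff f) := subst_C _
  rw [this, constantCoeff_C]

variable [Algebra ℚ K]

theorem constantCoeff_fexp {f : PowerSeries K} (hf : constantCoeff f = 0) :
    constantCoeff (fexp f) = 1 := by
  rw [fexp, constantCoeff_subst_of_zero hf, constantCoeff_exp]

theorem derivative_fexp {f : PowerSeries K} (hf : constantCoeff f = 0) :
    derivative K (fexp f) = derivative K f * fexp f := by
  rw [fexp, derivative_subst (.of_constantCoeff_zero' hf), derivative_exp, mul_comm]

theorem fexp_zero : fexp (0 : PowerSeries K) = 1 := by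
  refine eq_of_derivative_eq_mul (h := 0) ?_ ?_ ?_
  · rw [derivative_fexp (by simp)]; simp
  · simp
  · rw [constantCoeff_fexp (by simp)]; simp

theorem fexp_add {f g : PowerSeries K} (hf : constantCoeff f = 0) (hg : constantCoeff g = 0) :
    fexp (f + g) = fexp f * fexp g := by
  refine eq_of_derivative_eq_mul (h := derivative K f + derivative K g) ?_ ?_ ?_
  · rw [derivative_fexp (by simp [hf, hg]), map_add]
  · rw [Derivation.leibniz, derivative_fexp hf, derivative_fexp hg, smul_eq_mul, smul_eq_mul]
    ring
  · rw [map_mul, constantCoeff_fexp hf, constantCoeff_fexp hg,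
      constantCoeff_fexp (by simp [hf, hg]), one_mul]

theorem fexp_neg_mul_fexp {f : PowerSeries K} (hf : constantCoeff f = 0) :
    fexp (-f) * fexp f = 1 := by
  rw [← fexp_add (by simp [hf]) hf, neg_add_cancel, fexp_zero]

theorem fexp_pow {f : PowerSeries K} (hf : constantCoeff f = 0) (n : ℕ) :
    fexp f ^ n = fexp (C (n : K) * f) := by
  induction n with
  | zero => simp [fexp_zero]
  | succ n ih =>
    rw [pow_succ, ih, ← fexp_add (by simp [hf]) hf]
    congr 1
    push_cast
    rw [map_add, map_one]
    ring

theorem subst_fexp {a f : PowerSeries K} (ha : constantCoeff a = 0) (hf : constantCoeff f = 0) :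
    (fexp f).subst a = fexp (f.subst a) := by
  rw [fexp, fexp, subst_comp_subst_apply (.of_constantCoeff_zero' hf)
    (.of_constantCoeff_zero' ha)]

theorem map_fexp {K' : Type*} [CommRing K'] [Algebra ℚ K'] (φ : K →+* K') {f : PowerSeries K}
    (hf : constantCoeff f = 0) : map φ (fexp f) = fexp (map φ f) := by
  rw [fexp, fexp]
  have := PowerSeries.map_subst (a := f) (.of_constantCoeff_zero' hf) (h := φ) (exp K)
  rw [map_exp] at this
  exact this

theorem rescale_fexp (a : K) {f : PowerSeries K} (hf : constantCoeff f = 0) :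
    rescale a (fexp f) = fexp (rescale a f) := by
  rw [rescale_eq_subst, rescale_eq_subst, subst_fexp (by simp) hf]

theorem isUnit_fexp {f : PowerSeries K} (hf : constantCoeff f = 0) : IsUnit (fexp f) :=
  .of_mul_eq_one_right (fexp (-f)) (fexp_neg_mul_fexp hf)

end Exp

/-! ### The change of variables `x = z e^{-z^r}` -/

section Lambert

variable {r : ℕ}

theorem constantCoeff_neg_X_pow {K : Type*} [CommRing K] (hr : 0 < r) :
    constantCoeff (-(X ^ r) : PowerSeries K) = 0 := by
  simp [hr.ne']

theorem constantCoeff_lambertX (r : ℕ) : constantCoeff (lambertX r) = 0 := by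
  simp [lambertX]

theorem coeff_one_lambertX (hr : 0 < r) : coeff 1 (lambertX r) = 1 := by
  rw [lambertX, show 1 = 0 + 1 from rfl, coeff_succ_X_mul, coeff_zero_eq_constantCoeff_apply,
    constantCoeff_fexp (constantCoeff_neg_X_pow hr)]

theorem constantCoeff_emb_lambertX (r : ℕ) : constantCoeff (emb (lambertX r)) = 0 := by
  rw [emb, ← coeff_zero_eq_constantCoeff_apply, coeff_map, coeff_zero_eq_constantCoeff_apply,
    constantCoeff_lambertX, map_zero]

theorem hasSubst_lambertX (r : ℕ) : HasSubst (lambertX r) :=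
  .of_constantCoeff_zero' (constantCoeff_lambertX r)

theorem hasSubst_emb_lambertX (r : ℕ) : HasSubst (emb (lambertX r)) :=
  .of_constantCoeff_zero' (constantCoeff_emb_lambertX r)

theorem lambertX_pow (hr : 0 < r) :
    lambertX r ^ r = X ^ r * fexp (-(C (r : ℂ) * X ^ r)) := by
  rw [lambertX, mul_pow, fexp_pow (constantCoeff_neg_X_pow hr), mul_neg]

/-- Every series in `z` is a series in `x`. -/
theorem subst_surjective {K : Type*} [CommRing K] {a : PowerSeries K} (h0 : constantCoeff a = 0)
    (h1 : coeff 1 a = 1) (f : PowerSeries K) : ∃ g : PowerSeries K, g.subst a = f := by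
  have hu : IsUnit (coeff 1 a) := h1 ▸ isUnit_one
  refine ⟨f.subst (a.substInvOfIsUnit hu), ?_⟩
  rw [subst_comp_subst_apply (HasSubst.substInvOfIsUnit a hu) (.of_constantCoeff_zero' h0),
    subst_substInvOfIsUnit_left a h0, X_subst]

theorem exists_subst_lambertX (hr : 0 < r) (f : PowerSeries ℂ) :
    ∃ g : PowerSeries ℂ, g.subst (lambertX r) = f :=
  subst_surjective (constantCoeff_lambertX r) (coeff_one_lambertX hr) f

theorem exists_subst_emb_lambertX (hr : 0 < r) (f : Fun) :
    ∃ g : Fun, g.subst (emb (lambertX r)) = f :=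
  subst_surjective (constantCoeff_emb_lambertX r)
    (by rw [emb, coeff_map, coeff_one_lambertX hr, map_one]) f

/-- The logarithmic derivative of $ze^{-z^r}$ explains the factor $1-rz^r$ in $D$: it is exactly
what makes $Dx=x$. -/
theorem derivative_lambertX (hr : 0 < r) :
    X * derivative ℂ (lambertX r) = (1 - C (r : ℂ) * X ^ r) * lambertX r := by
  obtain ⟨m, rfl⟩ : ∃ m, r = m + 1 := ⟨r - 1, by omega⟩
  rw [lambertX, Derivation.leibniz, derivative_fexp (constantCoeff_neg_X_pow hr), map_neg,
    derivative_pow, derivative_X, smul_eq_mul, smul_eq_mul, map_natCast]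
  simp
  ring

theorem constantCoeff_one_sub (K : Type*) [Field K] (r : ℕ) :
    constantCoeff (1 - C (r : K) * X ^ r) ≠ 0 := by
  rcases Nat.eq_zero_or_pos r with rfl | h
  · simp
  · simp [h.ne']

theorem derivative_map {K K' : Type*} [CommRing K] [CommRing K'] (φ : K →+* K')
    (f : PowerSeries K) : derivative K' (map φ f) = map φ (derivative K f) := by
  ext n
  simp [coeff_derivative]

theorem derivative_emb_lambertX (hr : 0 < r) :
    X * derivative (LaurentSeries ℂ) (emb (lambertX r)) =
      (1 - C (r : LaurentSeries ℂ) * X ^ r) * emb (lambertX r) := by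
  have := congrArg emb (derivative_lambertX hr)
  rw [map_mul, map_mul] at this
  rw [emb, derivative_map, ← emb]
  simpa [emb] using this

theorem opD_eq (K : Type*) [Field K] (f : PowerSeries K) : opD r K f =
    X * (1 - C (r : K) * X ^ r)⁻¹ * derivative K f := rfl

theorem one_sub_mul_opD (K : Type*) [Field K] (f : PowerSeries K) :
    (1 - C (r : K) * X ^ r) * opD r K f = X * derivative K f := by
  rw [opD_eq]
  have := PowerSeries.mul_inv_cancel _ (constantCoeff_one_sub K r)
  linear_combination X * derivative K f * this

/-- `D` acts as `x ∂/∂x` on series in `x`. -/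
theorem opD_subst {K : Type*} [Field K] {a : PowerSeries K} (h0 : constantCoeff a = 0)
    (ha : X * derivative K a = (1 - C (r : K) * X ^ r) * a) (f : PowerSeries K) :
    opD r K (f.subst a) = (X * derivative K f).subst a := by
  have hs : HasSubst a := .of_constantCoeff_zero' h0
  have := PowerSeries.mul_inv_cancel _ (constantCoeff_one_sub K r)
  rw [opD_eq, derivative_subst hs, subst_mul hs, subst_X hs]
  linear_combination (1 - C (r : K) * X ^ r)⁻¹ * (derivative K f).subst a * ha
    + (derivative K f).subst a * a * this

theorem opD_subst_lambertX (hr : 0 < r) (f : PowerSeries ℂ) :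
    opD r ℂ (f.subst (lambertX r)) = (X * derivative ℂ f).subst (lambertX r) :=
  opD_subst (constantCoeff_lambertX r) (derivative_lambertX hr) f

theorem opD_subst_emb_lambertX (hr : 0 < r) (f : Fun) :
    opD r (LaurentSeries ℂ) (f.subst (emb (lambertX r))) =
      (X * derivative (LaurentSeries ℂ) f).subst (emb (lambertX r)) :=
  opD_subst (constantCoeff_emb_lambertX r) (derivative_emb_lambertX hr) f

theorem opD_mul {K : Type*} [Field K] (f g : PowerSeries K) :
    opD r K (f * g) = opD r K f * g + f * opD r K g := by
  simp only [opD_eq, Derivation.leibniz, smul_eq_mul]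
  ring

theorem opD_fexp {K : Type*} [Field K] [Algebra ℚ K] {f : PowerSeries K}
    (hf : constantCoeff f = 0) : opD r K (fexp f) = opD r K f * fexp f := by
  simp only [opD_eq, derivative_fexp hf]
  ring

theorem constantCoeff_opD {K : Type*} [Field K] (f : PowerSeries K) :
    constantCoeff (opD r K f) = 0 := by
  simp [opD_eq]

theorem opD_C {K : Type*} [Field K] (a : K) : opD r K (C a) = 0 := by
  simp [opD_eq]

theorem opD_C_mul {K : Type*} [Field K] (a : K) (f : PowerSeries K) :
    opD r K (C a * f) = C a * opD r K f := by
  rw [opD_mul, opD_C, zero_mul, zero_add]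

theorem eq_of_opD_eq {K : Type*} [Field K] [CharZero K] {f g : PowerSeries K}
    (h : opD r K f = opD r K g) (h0 : constantCoeff f = constantCoeff g) : f = g := by
  refine derivative.ext ?_ h0
  have := congrArg (fun u => (1 - C (r : K) * X ^ r) * u) h
  simp only [one_sub_mul_opD] at this
  exact X_mul_cancel this

end Lambert

end

end OrbifoldHurwitz

namespace OrbifoldHurwitz

noncomputable section

open PowerSeries

/-! ### The Euler operator `ħ ∂/∂ħ` -/

theorem ofPowerSeries_coeff_natCast (p : PowerSeries ℂ) (n : ℕ) :
    (HahnSeries.ofPowerSeries ℤ ℂ p).coeff n = coeff n p :=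
  HahnSeries.ofPowerSeries_apply_coeff p n

theorem ofPowerSeries_coeff_of_neg (p : PowerSeries ℂ) {n : ℤ} (hn : n < 0) :
    (HahnSeries.ofPowerSeries ℤ ℂ p).coeff n = 0 := by
  rw [HahnSeries.ofPowerSeries_apply]
  apply HahnSeries.embDomain_of_notMem_range
  rintro ⟨m, hm⟩
  have : (m : ℤ) = n := by simpa using hm
  omega

theorem hbar_eq_ofPowerSeries : hbar = HahnSeries.ofPowerSeries ℤ ℂ X := by
  rw [HahnSeries.ofPowerSeries_X, hbar]

theorem coeff_hbar_mul (f : LaurentSeries ℂ) (n : ℤ) : (hbar * f).coeff n = f.coeff (n - 1) := by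
  have := HahnSeries.coeff_single_mul_add (r := (1 : ℂ)) (x := f) (a := n - 1) (b := 1)
  rw [sub_add_cancel, one_mul] at this
  exact this

/-- `ħ ∂/∂ħ` on Laurent series in `ħ`. -/
def eulerHbar : LaurentSeries ℂ →+ LaurentSeries ℂ :=
  (AddMonoidHom.mulLeft hbar).comp (LaurentSeries.derivative ℂ).toAddMonoidHom

theorem eulerHbar_apply (f : LaurentSeries ℂ) :
    eulerHbar f = hbar * LaurentSeries.derivative ℂ f := rfl

theorem coeff_eulerHbar (f : LaurentSeries ℂ) (n : ℤ) :
    (eulerHbar f).coeff n = n * f.coeff n := by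
  rw [eulerHbar_apply, coeff_hbar_mul, LaurentSeries.derivative_apply,
    LaurentSeries.hasseDeriv_coeff]
  simp

/-- Weighting a coefficient by its exponent is a derivation because exponents add in products. The
weight can only shrink supports, so all three products may be summed over the pairs of exponents of
`f` and `g`. -/
theorem eulerHbar_mul (f g : LaurentSeries ℂ) :
    eulerHbar (f * g) = eulerHbar f * g + f * eulerHbar g := by
  have hs (u : LaurentSeries ℂ) : (eulerHbar u).support ⊆ u.support := fun n hn h0 => by
    refine hn ?_
    rw [coeff_eulerHbar, h0, mul_zero]
  ext n
  rw [coeff_eulerHbar, HahnSeries.coeff_add, HahnSeries.coeff_mul,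
    HahnSeries.coeff_mul_left' f.isPWO_support (hs f),
    HahnSeries.coeff_mul_right' g.isPWO_support (hs g), Finset.mul_sum, ← Finset.sum_add_distrib]
  refine Finset.sum_congr rfl fun p hp => ?_
  rw [Finset.mem_antidiagonal] at hp
  rw [coeff_eulerHbar, coeff_eulerHbar, ← hp.2.2]
  push_cast
  ring

theorem eulerHbar_C (c : ℂ) : eulerHbar (HahnSeries.C c) = 0 := by
  ext n
  rw [coeff_eulerHbar, HahnSeries.C_apply, HahnSeries.coeff_single]
  split_ifs with h
  · simp [h]
  · simp

theorem eulerHbar_natCast (n : ℕ) : eulerHbar (n : LaurentSeries ℂ) = 0 := by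
  rw [← map_natCast (HahnSeries.C : ℂ →+* LaurentSeries ℂ) n, eulerHbar_C]

theorem eulerHbar_ofPowerSeries (p : PowerSeries ℂ) :
    eulerHbar (HahnSeries.ofPowerSeries ℤ ℂ p) =
      HahnSeries.ofPowerSeries ℤ ℂ (X * derivative ℂ p) := by
  ext n
  rw [coeff_eulerHbar]
  rcases lt_or_ge n 0 with h | h
  · rw [ofPowerSeries_coeff_of_neg _ h, ofPowerSeries_coeff_of_neg _ h, mul_zero]
  · obtain ⟨m, rfl⟩ := Int.eq_ofNat_of_zero_le h
    rw [ofPowerSeries_coeff_natCast, ofPowerSeries_coeff_natCast]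
    cases m with
    | zero => simp
    | succ m =>
      rw [coeff_succ_X_mul, coeff_derivative]
      push_cast
      ring

theorem eulerHbar_hbar : eulerHbar hbar = hbar := by
  rw [hbar_eq_ofPowerSeries, eulerHbar_ofPowerSeries, derivative_X, mul_one]

theorem eulerHbar_expHbar (c : ℂ) :
    eulerHbar (expHbar c) = HahnSeries.C c * hbar * expHbar c := by
  have h : derivative ℂ (rescale c (exp ℂ)) = C c * rescale c (exp ℂ) := by
    ext n
    rw [coeff_derivative, coeff_rescale, coeff_C_mul, coeff_rescale, coeff_exp, coeff_exp,
      Nat.factorial_succ]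
    simp
    have : (n : ℂ) + 1 ≠ 0 := Nat.cast_add_one_ne_zero n
    field_simp
    rw [pow_succ']
  rw [expHbar, eulerHbar_ofPowerSeries, h, map_mul, map_mul, hbar_eq_ofPowerSeries,
    HahnSeries.ofPowerSeries_C]
  ring

theorem expHbar_zero : expHbar 0 = 1 := by
  rw [expHbar, rescale_zero]
  simp

theorem expHbar_add (a b : ℂ) : expHbar (a + b) = expHbar a * expHbar b := by
  rw [expHbar, expHbar, expHbar, ← map_mul, exp_mul_exp_eq_exp_add]

theorem expHbar_pow (c : ℂ) (n : ℕ) : expHbar c ^ n = expHbar (n * c) := by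
  induction n with
  | zero => simp [expHbar_zero]
  | succ n ih => rw [pow_succ, ih, ← expHbar_add]; congr 1; push_cast; ring

theorem end_mul_apply (S T : AddMonoid.End Fun) (f : Fun) : (S * T) f = S (T f) := rfl

theorem end_sub_apply (S T : AddMonoid.End Fun) (f : Fun) : (S - T) f = S f - T f := rfl

theorem mulOp_apply (a f : Fun) : mulOp a f = a * f := rfl

theorem coeff_dHbar (d : ℕ) (f : Fun) :
    coeff d (dHbar f) = LaurentSeries.derivative ℂ (coeff d f) :=
  coeff_mk d fun d => LaurentSeries.derivative ℂ (coeff d f)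

/-- `ħ ∂/∂ħ` on series in `z` and `ħ`. -/
def euler : AddMonoid.End Fun := mulOp (C hbar) * dHbar

theorem coeff_euler (d : ℕ) (f : Fun) : coeff d (euler f) = eulerHbar (coeff d f) := by
  rw [euler, end_mul_apply, mulOp_apply, coeff_C_mul, coeff_dHbar, eulerHbar_apply]

theorem euler_mul (f g : Fun) : euler (f * g) = euler f * g + f * euler g := by
  ext1 d
  rw [coeff_euler, coeff_mul, map_sum, map_add, coeff_mul, coeff_mul, ← Finset.sum_add_distrib]
  refine Finset.sum_congr rfl fun p _ => ?_
  rw [eulerHbar_mul, coeff_euler, coeff_euler]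

theorem euler_derivative (f : Fun) : euler (derivative (LaurentSeries ℂ) f) =
    derivative (LaurentSeries ℂ) (euler f) := by
  ext1 d
  rw [coeff_euler, coeff_derivative, coeff_derivative, coeff_euler, eulerHbar_mul]
  have : eulerHbar ((d : LaurentSeries ℂ) + 1) = 0 := by
    exact_mod_cast eulerHbar_natCast (d + 1)
  rw [this, mul_zero, add_zero]

theorem constantCoeff_euler {f : Fun} (hf : constantCoeff f = 0) :
    constantCoeff (euler f) = 0 := by
  rw [← coeff_zero_eq_constantCoeff_apply, coeff_euler, coeff_zero_eq_constantCoeff_apply, hf,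
    map_zero]

/-- The difference $u$ of the two sides satisfies $u'=f'u$ and has zero constant term, so it
vanishes by uniqueness for linear equations. -/
theorem euler_fexp {f : Fun} (hf : constantCoeff f = 0) :
    euler (fexp f) = euler f * fexp f := by
  rw [← sub_eq_zero]
  refine eq_of_derivative_eq_mul (h := derivative _ f) ?_ (by simp) ?_
  · rw [map_sub, ← euler_derivative, derivative_fexp hf, euler_mul, Derivation.leibniz,
      derivative_fexp hf, euler_derivative, smul_eq_mul, smul_eq_mul]
    ring
  · have h1 : constantCoeff (euler (fexp f)) = 0 := by
      rw [← coeff_zero_eq_constantCoeff_apply, coeff_euler, coeff_zero_eq_constantCoeff_apply,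
        constantCoeff_fexp hf]
      exact_mod_cast eulerHbar_natCast 1
    rw [map_sub, map_mul, h1, constantCoeff_euler hf]
    simp

/-! ### The operators in the variable `x` -/

theorem coeff_subst_eq_sum {K : Type*} [CommRing K] {a : PowerSeries K}
    (ha : constantCoeff a = 0) (f : PowerSeries K) (e : ℕ) :
    coeff e (f.subst a) = ∑ d ∈ Finset.range (e + 1), coeff d f * coeff e (a ^ d) := by
  rw [coeff_subst' (.of_constantCoeff_zero' ha)]
  rw [finsum_eq_sum_of_support_subset _ (s := Finset.range (e + 1)) fun d hd => ?_]
  · simp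
  · by_contra h
    refine hd ?_
    have h' : e < d := by simpa [Nat.lt_succ_iff] using h
    have hdvd : X ^ d ∣ a ^ d := pow_dvd_pow_of_dvd (X_dvd_iff.mpr ha) d
    change coeff d f • coeff e (a ^ d) = 0
    rw [X_pow_dvd_iff.mp hdvd e h', smul_zero]

theorem coeff_emb (d : ℕ) (f : PowerSeries ℂ) : coeff d (emb f) = HahnSeries.C (coeff d f) := by
  rw [emb, coeff_map]

theorem coeff_subst_emb {a : PowerSeries ℂ} (ha : constantCoeff a = 0) (f : Fun) (e : ℕ) :
    coeff e (f.subst (emb a)) =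
      ∑ d ∈ Finset.range (e + 1), coeff d f * HahnSeries.C (coeff e (a ^ d)) := by
  rw [coeff_subst_eq_sum]
  · simp_rw [← map_pow, coeff_emb]
  · rw [← coeff_zero_eq_constantCoeff_apply, coeff_emb, coeff_zero_eq_constantCoeff_apply, ha,
      map_zero]

/-- The substituted series does not involve $\hbar$, so the Euler operator sees only the
coefficients of `f`. -/
theorem euler_subst {a : PowerSeries ℂ} (ha : constantCoeff a = 0) (f : Fun) :
    euler (f.subst (emb a)) = (euler f).subst (emb a) := by
  ext1 e
  rw [coeff_euler, coeff_subst_emb ha, coeff_subst_emb ha, map_sum]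
  refine Finset.sum_congr rfl fun d _ => ?_
  rw [eulerHbar_mul, eulerHbar_C, mul_zero, add_zero, coeff_euler]

/-- Puts a product of Hahn series into the shape of the sum over $k$ by which `expOpD` is defined.
-/
theorem coeff_ofPowerSeries_mul (p : PowerSeries ℂ) (g : LaurentSeries ℂ) (j : ℤ) :
    (HahnSeries.ofPowerSeries ℤ ℂ p * g).coeff j = ∑ᶠ k : ℕ, coeff k p * g.coeff (j - k) := by
  classical
  set u := HahnSeries.ofPowerSeries ℤ ℂ p with hu
  have hnn : ∀ i ∈ u.support, 0 ≤ i := fun i hi => by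
    by_contra h
    exact hi (ofPowerSeries_coeff_of_neg p (not_le.mp h))
  rw [HahnSeries.coeff_mul]
  set s := Finset.antidiagonal u.isPWO_support g.isPWO_support j with hs
  rw [finsum_eq_sum_of_support_subset (s := s.image fun q => q.1.toNat)]
  · rw [Finset.sum_image]
    · refine Finset.sum_congr rfl fun q hq => ?_
      rw [Finset.mem_antidiagonal] at hq
      have h0 := hnn _ hq.1
      obtain ⟨m, hm⟩ := Int.eq_ofNat_of_zero_le h0
      have h2 : q.2 = j - m := by have := hq.2.2; omega
      rw [hm, h2, hu, ofPowerSeries_coeff_natCast]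
      simp
    · intro q hq q' hq' h
      simp only [hs, Finset.mem_coe, Finset.mem_antidiagonal] at hq hq'
      have h0 := hnn _ hq.1
      have h0' := hnn _ hq'.1
      have e1 := hq.2.2
      have e2 := hq'.2.2
      simp only at h
      ext <;> omega
  · intro k hk
    have h1 : coeff k p ≠ 0 := left_ne_zero_of_mul hk
    have h2 : g.coeff (j - k) ≠ 0 := right_ne_zero_of_mul hk
    rw [Finset.coe_image]
    refine ⟨((k : ℤ), j - k), ?_, by simp⟩
    rw [Finset.mem_coe, hs, Finset.mem_antidiagonal]
    refine ⟨?_, h2, by ring⟩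
    change u.coeff k ≠ 0
    rwa [hu, ofPowerSeries_coeff_natCast]

theorem coeff_expHbar_mul (c : ℂ) (g : LaurentSeries ℂ) (j : ℤ) :
    (expHbar c * g).coeff j = ∑ᶠ k : ℕ, c ^ k / k.factorial * g.coeff (j - k) := by
  rw [expHbar, coeff_ofPowerSeries_mul]
  refine finsum_congr fun k => ?_
  rw [coeff_rescale, coeff_exp]
  simp [div_eq_mul_inv]

theorem laurent_finite_support (c : ℕ → ℂ) (g : LaurentSeries ℂ) (j : ℤ) :
    (Function.support fun k : ℕ => c k * g.coeff (j - k)).Finite := by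
  refine (Set.finite_Iic (j - g.order).toNat).subset fun k hk => ?_
  have h2 : g.coeff (j - k) ≠ 0 := right_ne_zero_of_mul hk
  have := HahnSeries.order_le_of_coeff_ne_zero h2
  simp only [Set.mem_Iic]
  omega

/-- `x ∂/∂x`. -/
def eulerX (f : Fun) : Fun := X * derivative (LaurentSeries ℂ) f

theorem coeff_eulerX (d : ℕ) (f : Fun) : coeff d (eulerX f) = d * coeff d f := by
  cases d with
  | zero => simp [eulerX]
  | succ d =>
    rw [eulerX, coeff_succ_X_mul, coeff_derivative]
    push_cast
    ring

theorem coeff_eulerX_iterate (k d : ℕ) (f : Fun) :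
    coeff d (eulerX^[k] f) = (d : LaurentSeries ℂ) ^ k * coeff d f := by
  induction k with
  | zero => simp
  | succ k ih => rw [Function.iterate_succ_apply', coeff_eulerX, ih, pow_succ']; ring

section

variable {r : ℕ}

theorem opD_iterate_subst (hr : 0 < r) (k : ℕ) (f : Fun) :
    (opD r (LaurentSeries ℂ))^[k] (f.subst (emb (lambertX r))) =
      (eulerX^[k] f).subst (emb (lambertX r)) := by
  induction k with
  | zero => rfl
  | succ k ih =>
    rw [Function.iterate_succ_apply', Function.iterate_succ_apply', ih,
      opD_subst_emb_lambertX hr, eulerX]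

theorem natCast_pow_mul_eq_smul (d k : ℕ) (f : LaurentSeries ℂ) :
    (d : LaurentSeries ℂ) ^ k * f = ((d : ℂ) ^ k) • f := by
  rw [← HahnSeries.C_mul_eq_smul, map_pow, map_natCast]

theorem coeff_mul_laurent_C (f : LaurentSeries ℂ) (c : ℂ) (j : ℤ) :
    (f * HahnSeries.C c).coeff j = c * f.coeff j := by
  rw [mul_comm, HahnSeries.C_mul_eq_smul, HahnSeries.coeff_smul, smul_eq_mul]

theorem coeff_expOpD (c : ℂ) (f : Fun) (d : ℕ) (j : ℤ) :
    (coeff d (expOpD r c f)).coeff j = ∑ᶠ k, expTerm r c f d j k := by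
  have : coeff d (expOpD r c f) = HahnSeries.ofSuppBddBelow
      (fun j => ∑ᶠ k, expTerm r c f d j k) (expTerm_bddBelow r c f d) :=
    coeff_mk d fun d => HahnSeries.ofSuppBddBelow
      (fun j => ∑ᶠ k, expTerm r c f d j k) (expTerm_bddBelow r c f d)
  rw [this, HahnSeries.coeff_ofSuppBddBelow]

/-- `e^{cħD}` is the rescaling `x ↦ e^{cħ} x`. -/
theorem expOpD_subst (hr : 0 < r) (c : ℂ) (f : Fun) :
    expOpD r c (f.subst (emb (lambertX r))) =
      (rescale (expHbar c) f).subst (emb (lambertX r)) := by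
  ext d j
  rw [coeff_expOpD, coeff_subst_emb (constantCoeff_lambertX r),
    HahnSeries.coeff_sum]
  -- Since $D$ multiplies $x^i$ by $i$, the $k$-th term acts on $x^i$ as $(ic\hbar)^k/k!$. Summing
  -- over $k$ first then gives $e^{ic\hbar}$.
  have h1 : ∀ k, expTerm r c (f.subst (emb (lambertX r))) d j k =
      ∑ i ∈ Finset.range (d + 1), coeff d (lambertX r ^ i) *
        ((i * c) ^ k / k.factorial * (coeff i f).coeff (j - k)) := fun k => by
    rw [expTerm, opD_iterate_subst hr, coeff_subst_emb (constantCoeff_lambertX r),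
      HahnSeries.coeff_sum, Finset.mul_sum]
    refine Finset.sum_congr rfl fun i _ => ?_
    rw [coeff_eulerX_iterate, coeff_mul_laurent_C, natCast_pow_mul_eq_smul,
      HahnSeries.coeff_smul, smul_eq_mul]
    ring
  have h2 : ∀ i, (Function.support fun k : ℕ => coeff d (lambertX r ^ i) *
        ((i * c) ^ k / k.factorial * (coeff i f).coeff (j - k))).Finite := fun i => by
    refine (laurent_finite_support (fun k => (i * c) ^ k / k.factorial) (coeff i f) j).subset ?_
    exact fun k hk => right_ne_zero_of_mul hk
  simp_rw [h1]
  rw [finsum_sum_comm _ _ fun i _ => h2 i]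
  refine Finset.sum_congr rfl fun i _ => ?_
  rw [coeff_rescale, expHbar_pow, coeff_mul_laurent_C, coeff_expHbar_mul, mul_finsum]

/-- The operator `P` in the variable `x`. -/
def opPX (r : ℕ) (f : Fun) : Fun :=
  C hbar * eulerX f -
    X ^ r * (C (expHbar ((r : ℂ) * ((r : ℂ) - 1) / 2)) * rescale (expHbar r) f)

/-- The operator `Q` in the variable `x`. -/
def opQX (r : ℕ) (f : Fun) : Fun :=
  C (HahnSeries.C (1 / 2 : ℂ) * hbar) * eulerX (eulerX f) -
    C (HahnSeries.C (1 / (r : ℂ)) + HahnSeries.C (1 / 2 : ℂ) * hbar) * eulerX f - euler f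

theorem subst_C_mul {a : Fun} (ha : HasSubst a) (c : LaurentSeries ℂ) (f : Fun) :
    (C c * f).subst a = C c * f.subst a := by
  have : (C c).subst a = C c := subst_C c
  rw [subst_mul ha, this]

theorem opP_apply (f : Fun) : opP r f = C hbar * opD r (LaurentSeries ℂ) f -
    emb (lambertX r) ^ r * C (expHbar ((r : ℂ) * ((r : ℂ) - 1) / 2)) * expOpD r r f := rfl

theorem opQ_apply (f : Fun) : opQ r f =
    C (HahnSeries.C (1 / 2 : ℂ) * hbar) * opD r (LaurentSeries ℂ) (opD r (LaurentSeries ℂ) f) -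
    C (HahnSeries.C (1 / (r : ℂ)) + HahnSeries.C (1 / 2 : ℂ) * hbar) *
      opD r (LaurentSeries ℂ) f - euler f := rfl

theorem opP_subst (hr : 0 < r) (f : Fun) :
    opP r (f.subst (emb (lambertX r))) = (opPX r f).subst (emb (lambertX r)) := by
  have hs := hasSubst_emb_lambertX r
  rw [opP_apply, opPX, subst_sub hs, subst_C_mul hs, subst_mul hs, subst_C_mul hs,
    opD_subst_emb_lambertX hr, expOpD_subst hr, subst_pow hs, subst_X hs, mul_assoc, eulerX]

theorem opQ_subst (hr : 0 < r) (f : Fun) :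
    opQ r (f.subst (emb (lambertX r))) = (opQX r f).subst (emb (lambertX r)) := by
  have hs := hasSubst_emb_lambertX r
  rw [opQ_apply, opQX, subst_sub hs, subst_sub hs, subst_C_mul hs, subst_C_mul hs,
    opD_subst_emb_lambertX hr, opD_subst_emb_lambertX hr,
    euler_subst (constantCoeff_lambertX r), eulerX, eulerX]

/-- The exponent $\frac{r(r-1)}2+(d-r)r$ equals $\binom d2-\binom{d-r}2$. This is the role of the
shift $\frac{r-1}2\hbar$ in $P$. -/
theorem coeff_opPX (d : ℕ) (f : Fun) : coeff d (opPX r f) = hbar * (d * coeff d f) -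
    if r ≤ d then expHbar ((r : ℂ) * ((r : ℂ) - 1) / 2 + (d - r : ℕ) * r) * coeff (d - r) f
    else 0 := by
  rw [opPX, map_sub, coeff_C_mul, coeff_eulerX, coeff_X_pow_mul']
  split_ifs with h
  · rw [coeff_C_mul, coeff_rescale, expHbar_pow, expHbar_add, mul_assoc]
  · rfl

theorem coeff_opQX (d : ℕ) (f : Fun) : coeff d (opQX r f) =
    (HahnSeries.C (1 / 2 : ℂ) * hbar * ((d : LaurentSeries ℂ) * (d : LaurentSeries ℂ)) -
      (HahnSeries.C (1 / (r : ℂ)) + HahnSeries.C (1 / 2 : ℂ) * hbar) * (d : LaurentSeries ℂ)) *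
        coeff d f -
      eulerHbar (coeff d f) := by
  rw [opQX, map_sub, map_sub, coeff_C_mul, coeff_C_mul, coeff_eulerX, coeff_eulerX, coeff_euler]
  ring

/-- On $x^d$ the operator $Q$ is $\hbar\binom d2-\frac dr-\hbar\partial_\hbar$. The term $\hbar d$
of $P$ is reproduced by $\hbar\partial_\hbar\hbar=\hbar$. In the shift term, the jump of
$\hbar\binom d2$ from $d-r$ to $d$ cancels the derivative of the exponential, and the jump of $d/r$
by $1$ reproduces the term. -/
theorem opPX_opQX_sub (hr : 0 < r) (f : Fun) :
    opPX r (opQX r f) - opQX r (opPX r f) = opPX r f := by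
  ext1 d
  rw [map_sub, coeff_opPX, coeff_opQX, coeff_opQX, coeff_opQX, coeff_opPX]
  split_ifs with h
  · obtain ⟨m, rfl⟩ := Nat.exists_eq_add_of_le' h
    rw [map_sub, eulerHbar_mul, eulerHbar_mul, eulerHbar_mul, eulerHbar_hbar, eulerHbar_natCast,
      eulerHbar_expHbar, Nat.add_sub_cancel]
    have e1 : (HahnSeries.C ((r : ℂ) * ((r : ℂ) - 1) / 2 + m * r) : LaurentSeries ℂ) =
        HahnSeries.C (1 / 2 : ℂ) * ((r : LaurentSeries ℂ) * ((r : LaurentSeries ℂ) - 1)) +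
          (m : LaurentSeries ℂ) * (r : LaurentSeries ℂ) := by
      rw [show ((r : ℂ) * ((r : ℂ) - 1) / 2 + m * r) = 1 / 2 * (r * (r - 1)) + m * r by ring]
      simp only [map_add, map_mul, map_sub, map_natCast, map_one]
    have e2 : (HahnSeries.C (1 / 2 : ℂ) : LaurentSeries ℂ) * 2 = 1 := by
      rw [show (2 : LaurentSeries ℂ) = HahnSeries.C 2 from (map_ofNat _ 2).symm, ← map_mul]
      norm_num
    have e3 : (HahnSeries.C (1 / (r : ℂ)) : LaurentSeries ℂ) * r = 1 := by
      rw [← map_natCast (HahnSeries.C : ℂ →+* LaurentSeries ℂ) r, ← map_mul,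
        one_div_mul_cancel (Nat.cast_ne_zero.mpr hr.ne'), map_one]
    rw [e1]
    push_cast
    set E := expHbar ((r : ℂ) * ((r : ℂ) - 1) / 2 + m * r)
    linear_combination (-E * coeff m f) * e3 + (E * coeff m f * hbar * m * r) * e2
  · rw [sub_zero, sub_zero, eulerHbar_mul, eulerHbar_mul, eulerHbar_hbar, eulerHbar_natCast]
    ring

theorem commutator (hr : 0 < r) : opP r * opQ r - opQ r * opP r = opP r := by
  ext1 f
  obtain ⟨g, rfl⟩ := exists_subst_emb_lambertX hr f
  rw [end_sub_apply, end_mul_apply, end_mul_apply, opQ_subst hr, opP_subst hr, opP_subst hr, opQ_subst hr,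
    ← subst_sub (hasSubst_emb_lambertX r), opPX_opQX_sub hr]

end

end

end OrbifoldHurwitz

namespace OrbifoldHurwitz

noncomputable section

open PowerSeries

/-! ### Leading terms in `ħ` -/

/-- Series in `z` over `ℂ[[ħ]]` as series over `ℂ((ħ))`. -/
def embPS : PowerSeries (PowerSeries ℂ) →+* Fun := PowerSeries.map (HahnSeries.ofPowerSeries ℤ ℂ)

/-- The value at `ħ = 0`. -/
def evalZero : PowerSeries (PowerSeries ℂ) →+* PowerSeries ℂ := PowerSeries.map constantCoeff

theorem coeff_embPS (d : ℕ) (G : PowerSeries (PowerSeries ℂ)) :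
    coeff d (embPS G) = HahnSeries.ofPowerSeries ℤ ℂ (coeff d G) := by
  rw [embPS, coeff_map]

theorem coeff_single_mul (k j : ℤ) (f : LaurentSeries ℂ) :
    ((HahnSeries.single k (1 : ℂ) : LaurentSeries ℂ) * f).coeff j = f.coeff (j - k) := by
  have := HahnSeries.coeff_single_mul_add (r := (1 : ℂ)) (x := f) (a := j - k) (b := k)
  rwa [sub_add_cancel, one_mul] at this

/-- Factoring out $\hbar^k$ leaves a series over $\mathbb C[[\hbar]]$, where taking the leading term
is the ring homomorphism $\hbar\mapsto0$. Compatibility with products and exponentials follows. -/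
theorem hasLeadingTerm_iff (G : Fun) (k : ℤ) (L : PowerSeries ℂ) : HasLeadingTerm G k L ↔
    ∃ G₀, G = C (HahnSeries.single k (1 : ℂ)) * embPS G₀ ∧ evalZero G₀ = L := by
  constructor
  · intro h
    refine ⟨.mk fun d => .mk fun n => (coeff d G).coeff (k + n), ?_, ?_⟩
    · ext d j
      rw [coeff_C_mul, coeff_single_mul, coeff_embPS, coeff_mk]
      rcases lt_or_ge (j - k) 0 with hj | hj
      · rw [ofPowerSeries_coeff_of_neg _ hj, (h d).1 j (by omega)]
      · obtain ⟨n, hn⟩ := Int.eq_ofNat_of_zero_le hj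
        rw [hn, ofPowerSeries_coeff_natCast, coeff_mk, ← hn, add_sub_cancel]
    · ext d
      rw [evalZero, coeff_map, coeff_mk, ← coeff_zero_eq_constantCoeff_apply, coeff_mk, ← (h d).2]
      simp
  · rintro ⟨G₀, rfl, rfl⟩ d
    refine ⟨fun j hj => ?_, ?_⟩
    · rw [coeff_C_mul, coeff_single_mul, coeff_embPS, ofPowerSeries_coeff_of_neg _ (by omega)]
    · rw [coeff_C_mul, coeff_single_mul, coeff_embPS, sub_self]
      have := ofPowerSeries_coeff_natCast (coeff d G₀) 0
      rw [Nat.cast_zero] at this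
      rw [this, coeff_zero_eq_constantCoeff_apply, evalZero, coeff_map]

namespace HasLeadingTerm

variable {G G' : Fun} {k k' : ℤ} {L L' : PowerSeries ℂ}

theorem unique (h : HasLeadingTerm G k L) (h' : HasLeadingTerm G k L') : L = L' := by
  ext d
  rw [← (h d).2, (h' d).2]

theorem zero (k : ℤ) : HasLeadingTerm 0 k 0 := fun d => by simp

theorem add (h : HasLeadingTerm G k L) (h' : HasLeadingTerm G' k L') :
    HasLeadingTerm (G + G') k (L + L') := fun d =>
  ⟨fun j hj => by rw [map_add, HahnSeries.coeff_add, (h d).1 j hj, (h' d).1 j hj, add_zero],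
    by rw [map_add, HahnSeries.coeff_add, (h d).2, (h' d).2, map_add]⟩

theorem neg (h : HasLeadingTerm G k L) : HasLeadingTerm (-G) k (-L) := fun d =>
  ⟨fun j hj => by rw [map_neg, HahnSeries.coeff_neg, (h d).1 j hj, neg_zero],
    by rw [map_neg, HahnSeries.coeff_neg, (h d).2, map_neg]⟩

theorem sub (h : HasLeadingTerm G k L) (h' : HasLeadingTerm G' k L') :
    HasLeadingTerm (G - G') k (L - L') := by
  rw [sub_eq_add_neg, sub_eq_add_neg]
  exact h.add h'.neg

theorem of_lt (h : HasLeadingTerm G k L) (hk : k' < k) : HasLeadingTerm G k' 0 := fun d =>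
  ⟨fun j hj => (h d).1 j (hj.trans hk), by rw [(h d).1 k' hk, map_zero]⟩

theorem mul (h : HasLeadingTerm G k L) (h' : HasLeadingTerm G' k' L') :
    HasLeadingTerm (G * G') (k + k') (L * L') := by
  rw [hasLeadingTerm_iff] at *
  obtain ⟨A, rfl, rfl⟩ := h
  obtain ⟨B, rfl, rfl⟩ := h'
  refine ⟨A * B, ?_, map_mul _ _ _⟩
  have : (HahnSeries.single (k + k') (1 : ℂ) : LaurentSeries ℂ) =
      HahnSeries.single k 1 * HahnSeries.single k' 1 := by
    rw [HahnSeries.single_mul_single, one_mul]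
  rw [this, map_mul, map_mul]
  ring

theorem emb (u : PowerSeries ℂ) : HasLeadingTerm (emb u) 0 u := fun d => by
  rw [coeff_emb, HahnSeries.C_apply]
  refine ⟨fun j hj => HahnSeries.coeff_single_of_ne hj.ne, HahnSeries.coeff_single_same _ _⟩

theorem C_hbar : HasLeadingTerm (C hbar) 1 1 := by
  rw [hasLeadingTerm_iff]
  exact ⟨1, by rw [map_one embPS, mul_one, hbar], map_one _⟩

theorem C_C (c : ℂ) : HasLeadingTerm (C (HahnSeries.C c)) 0 (C c) := by
  have := HasLeadingTerm.emb (C c)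
  rwa [OrbifoldHurwitz.emb, map_C] at this

theorem C_expHbar (c : ℂ) : HasLeadingTerm (C (expHbar c)) 0 1 := by
  rw [hasLeadingTerm_iff]
  refine ⟨C (rescale c (exp ℂ)), ?_, ?_⟩
  · rw [embPS, map_C, expHbar]
    have : (HahnSeries.single 0 (1 : ℂ) : LaurentSeries ℂ) = 1 := rfl
    rw [this, map_one, one_mul]
  · rw [evalZero, map_C, ← coeff_zero_eq_constantCoeff_apply, coeff_rescale]
    simp

theorem fexp (h : HasLeadingTerm G 0 L) (h0 : constantCoeff G = 0) :
    HasLeadingTerm (fexp G) 0 (fexp L) := by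
  have hone : (C (HahnSeries.single 0 (1 : ℂ) : LaurentSeries ℂ) : Fun) = 1 :=
    map_one (C : LaurentSeries ℂ →+* Fun)
  rw [hasLeadingTerm_iff] at *
  obtain ⟨A, rfl, rfl⟩ := h
  rw [hone, one_mul] at h0 ⊢
  have hA : constantCoeff A = 0 := by
    rw [← coeff_zero_eq_constantCoeff_apply, coeff_embPS, coeff_zero_eq_constantCoeff_apply] at h0
    exact HahnSeries.ofPowerSeries_injective (Γ := ℤ) (by rw [h0, map_zero])
  refine ⟨OrbifoldHurwitz.fexp A, ?_, map_fexp _ hA⟩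
  rw [one_mul, embPS, map_fexp _ hA]

theorem opD {r : ℕ} (h : HasLeadingTerm G k L) :
    HasLeadingTerm (opD r (LaurentSeries ℂ) G) k (opD r ℂ L) := by
  have h1 : HasLeadingTerm (derivative (LaurentSeries ℂ) G) k (derivative ℂ L) := fun d => by
    have e : ∀ j, (coeff d (derivative (LaurentSeries ℂ) G)).coeff j =
        (d + 1) * (coeff (d + 1) G).coeff j := fun j => by
      rw [coeff_derivative]
      have : ((d : LaurentSeries ℂ) + 1) = HahnSeries.C ((d : ℂ) + 1) := by
        rw [map_add, map_one, map_natCast]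
      rw [this, coeff_mul_laurent_C]
    refine ⟨fun j hj => ?_, ?_⟩
    · rw [e, (h _).1 j hj, mul_zero]
    · rw [e, (h _).2, coeff_derivative, mul_comm]
  have h2 := (HasLeadingTerm.emb (X * (1 - C (r : ℂ) * X ^ r)⁻¹)).mul h1
  rw [zero_add, map_mul, emb_inv] at h2
  rw [opD_eq, opD_eq]
  have : OrbifoldHurwitz.emb X = X := by rw [OrbifoldHurwitz.emb, map_X]
  rwa [this] at h2

theorem euler (h : HasLeadingTerm G k L) : HasLeadingTerm (euler G) k (C (k : ℂ) * L) := fun d => by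
  rw [coeff_euler]
  refine ⟨fun j hj => ?_, ?_⟩
  · rw [coeff_eulerHbar, (h d).1 j hj, mul_zero]
  · rw [coeff_eulerHbar, (h d).2, coeff_C_mul]

/-- The $k$-th term of the exponential starts at $\hbar^{k-1}$. The term $k=0$ is subtracted, so
only $k=1$ reaches $\hbar^0$. -/
theorem expOpD_sub {r : ℕ} (h : HasLeadingTerm G (-1) L) (c : ℂ) :
    HasLeadingTerm (expOpD r c G - G) 0 (C c * OrbifoldHurwitz.opD r ℂ L) := fun d => by
  have hord : OrdGE d (-1) G := fun i _ j hj => (h i).1 j hj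
  have hz : ∀ j : ℤ, ∀ k : ℕ, j - k < -1 → expTerm r c G d j k = 0 := fun j k hk =>
    expTerm_eq_zero hord hk
  have h0 : ∀ j, expTerm r c G d j 0 = (coeff d G).coeff j := fun j => by simp [expTerm]
  refine ⟨fun j hj => ?_, ?_⟩
  · rw [map_sub, HahnSeries.coeff_sub, coeff_expOpD, finsum_eq_single _ 0, h0, sub_self]
    intro k hk
    exact hz j k (by omega)
  · rw [map_sub, HahnSeries.coeff_sub, coeff_expOpD,
      finsum_eq_sum_of_support_subset (s := Finset.range 2)]
    · rw [Finset.sum_range_succ, Finset.sum_range_one, h0, add_sub_cancel_left, expTerm,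
        Function.iterate_one]
      have := (h.opD (r := r) d).2
      simp only [Nat.cast_one, zero_sub, this, coeff_C_mul, pow_one, Nat.factorial_one, div_one]
    · intro k hk
      by_contra hk'
      refine hk (hz 0 k ?_)
      simp only [Finset.coe_range, Set.mem_Iio, not_lt] at hk'
      omega

end HasLeadingTerm

theorem hasLeadingTerm_phase (S : ℕ → PowerSeries ℂ) : HasLeadingTerm (phase S) (-1) (S 0) := by
  rw [hasLeadingTerm_iff]
  refine ⟨.mk fun d => .mk fun m => coeff d (S m), ?_, ?_⟩
  · ext1 d
    rw [coeff_C_mul, coeff_embPS, coeff_mk, phase, coeff_mk]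
  · ext d
    rw [evalZero, coeff_map, coeff_mk, ← coeff_zero_eq_constantCoeff_apply, coeff_mk]

theorem constantCoeff_phase {S : ℕ → PowerSeries ℂ} (hS : ∀ m, constantCoeff (S m) = 0) :
    constantCoeff (phase S) = 0 := by
  rw [← coeff_zero_eq_constantCoeff_apply, phase, coeff_mk]
  have : (PowerSeries.mk fun m => coeff 0 (S m)) = 0 := by
    ext m
    rw [coeff_mk, coeff_zero_eq_constantCoeff_apply, hS, map_zero]
  rw [this, map_zero, mul_zero]

/-! ### Conjugation of the operators by a WKB exponential -/

section Semiclassical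

variable {r : ℕ}

/-- In the variable $x$ the operator is a rescaling, hence a ring endomorphism, and rescalings
commute with the exponential. -/
theorem expOpD_fexp (hr : 0 < r) (c : ℂ) {f : Fun} (hf : constantCoeff f = 0) :
    expOpD r c (fexp f) = fexp (expOpD r c f) := by
  have h0 := constantCoeff_emb_lambertX r
  obtain ⟨g, rfl⟩ := exists_subst_emb_lambertX hr f
  rw [constantCoeff_subst_of_zero h0] at hf
  have hg : constantCoeff (rescale (expHbar c) g) = 0 := by
    rw [← coeff_zero_eq_constantCoeff_apply, coeff_rescale, coeff_zero_eq_constantCoeff_apply, hf,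
      mul_zero]
  rw [← subst_fexp h0 hf, expOpD_subst hr, rescale_fexp _ hf, subst_fexp h0 hg, expOpD_subst hr]

theorem constantCoeff_expOpD (hr : 0 < r) (c : ℂ) {f : Fun} (hf : constantCoeff f = 0) :
    constantCoeff (expOpD r c f) = 0 := by
  have h0 := constantCoeff_emb_lambertX r
  obtain ⟨g, rfl⟩ := exists_subst_emb_lambertX hr f
  rw [constantCoeff_subst_of_zero h0] at hf
  rw [expOpD_subst hr, constantCoeff_subst_of_zero h0, ← coeff_zero_eq_constantCoeff_apply,
    coeff_rescale, coeff_zero_eq_constantCoeff_apply, hf, mul_zero]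

theorem fexp_neg_mul_opP_fexp (hr : 0 < r) {φ : Fun} (hφ : constantCoeff φ = 0) :
    fexp (-φ) * opP r (fexp φ) = C hbar * opD r (LaurentSeries ℂ) φ -
      emb (lambertX r ^ r) * C (expHbar ((r : ℂ) * ((r : ℂ) - 1) / 2)) *
        fexp (expOpD r r φ - φ) := by
  have h1 := fexp_neg_mul_fexp hφ
  have h2 : fexp (expOpD r r φ - φ) = fexp (expOpD r r φ) * fexp (-φ) := by
    rw [sub_eq_add_neg, fexp_add (constantCoeff_expOpD hr _ hφ) (by simp [hφ])]
  rw [opP_apply, opD_fexp hφ, expOpD_fexp hr _ hφ, h2, map_pow]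
  linear_combination C hbar * opD r (LaurentSeries ℂ) φ * h1

theorem fexp_neg_mul_opQ_fexp {φ : Fun} (hφ : constantCoeff φ = 0) :
    fexp (-φ) * opQ r (fexp φ) =
      C (HahnSeries.C (1 / 2 : ℂ)) * C hbar * (opD r (LaurentSeries ℂ) φ * opD r (LaurentSeries ℂ) φ
        + opD r (LaurentSeries ℂ) (opD r (LaurentSeries ℂ) φ)) -
      (C (HahnSeries.C (1 / (r : ℂ))) * opD r (LaurentSeries ℂ) φ +
        C (HahnSeries.C (1 / 2 : ℂ)) * C hbar * opD r (LaurentSeries ℂ) φ) - euler φ := by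
  have h1 := fexp_neg_mul_fexp hφ
  rw [opQ_apply, opD_fexp hφ, opD_mul, opD_fexp hφ, euler_fexp hφ, map_mul, map_add, map_mul]
  set a := opD r (LaurentSeries ℂ) φ
  linear_combination (C (HahnSeries.C (1 / 2 : ℂ)) * C hbar * (a * a +
        opD r (LaurentSeries ℂ) a) - (C (HahnSeries.C (1 / (r : ℂ))) * a +
        C (HahnSeries.C (1 / 2 : ℂ)) * C hbar * a) - euler φ) * h1

theorem semiclassicalLimit_opP (hr : 0 < r) : IsSemiclassicalLimit (opP r) 0 (fun S =>
    opD r ℂ S - lambertX r ^ r * fexp (C (r : ℂ) * opD r ℂ S)) := by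
  intro S hS
  have h0 := constantCoeff_phase hS
  have h := hasLeadingTerm_phase S
  rw [fexp_neg_mul_opP_fexp hr h0]
  have h1 := HasLeadingTerm.C_hbar.mul (h.opD (r := r))
  have h2 := (h.expOpD_sub (r := r) r).fexp
    (by rw [map_sub, constantCoeff_expOpD hr _ h0, h0, sub_zero])
  have h3 := ((HasLeadingTerm.emb (lambertX r ^ r)).mul
    (HasLeadingTerm.C_expHbar ((r : ℂ) * ((r : ℂ) - 1) / 2))).mul h2
  have h4 := h1.sub h3
  rwa [one_mul, mul_one] at h4

theorem semiclassicalLimit_opQ (r : ℕ) : IsSemiclassicalLimit (opQ r) (-1) (fun S =>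
    (1 / 2 : ℂ) • opD r ℂ S ^ 2 - (1 / (r : ℂ)) • opD r ℂ S + S) := by
  intro S hS
  have h := hasLeadingTerm_phase S
  rw [fexp_neg_mul_opQ_fexp (constantCoeff_phase hS)]
  have hD := h.opD (r := r)
  have hh := (HasLeadingTerm.C_C (1 / 2)).mul HasLeadingTerm.C_hbar
  -- $(D\varphi)^2$ starts at $\hbar^{-2}$ but $D^2\varphi$ only at $\hbar^{-1}$, so the latter is
  -- demoted to a zero leading term. The same happens to $\frac\hbar2D\varphi$ beside
  -- $\frac1rD\varphi$. The term $+S_0$ comes from $-\hbar\partial_\hbar$ acting on $\hbar^{-1}S_0$.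
  have h1 := hh.mul ((hD.mul hD).add ((hD.opD (r := r)).of_lt (show (-1 + -1 : ℤ) < -1 by norm_num)))
  have h2 := ((HasLeadingTerm.C_C (1 / (r : ℂ))).mul hD).add
    ((hh.mul hD).of_lt (show (0 + -1 : ℤ) < 0 + 1 + -1 by norm_num))
  have h3 := (h1.sub h2).sub h.euler
  convert h3 using 1
  · norm_num
  · simp only [smul_eq_C_mul]
    push_cast
    rw [map_neg, map_one]
    ring

end Semiclassical

/-! ### The Lambert curve -/

section Curve

variable {r : ℕ}

theorem semiclassical_P_iff (S : PowerSeries ℂ) :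
    opD r ℂ S - lambertX r ^ r * fexp (C (r : ℂ) * opD r ℂ S) = 0 ↔
      OnLambertCurve r (opD r ℂ S) := by
  have h0 : constantCoeff (C (r : ℂ) * opD r ℂ S) = 0 := by
    rw [map_mul, constantCoeff_opD, mul_zero]
  have h1 := fexp_neg_mul_fexp h0
  rw [OnLambertCurve]
  constructor
  · intro h
    linear_combination (-fexp (-(C (r : ℂ) * opD r ℂ S))) * h - lambertX r ^ r * h1
  · intro h
    rw [h]
    linear_combination (-opD r ℂ S) * h1

theorem coeff_X_mul_derivative {K : Type*} [CommRing K] (d : ℕ) (f : PowerSeries K) :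
    coeff d (X * derivative K f) = d * coeff d f := by
  cases d with
  | zero => simp
  | succ d =>
    rw [coeff_succ_X_mul, coeff_derivative]
    push_cast
    ring

theorem opD_lambertX_pow (hr : 0 < r) :
    opD r ℂ (lambertX r ^ r) = C (r : ℂ) * lambertX r ^ r := by
  have hs := hasSubst_lambertX r
  have h1 : lambertX r ^ r = (X ^ r : PowerSeries ℂ).subst (lambertX r) := by
    rw [subst_pow hs, subst_X hs]
  have h2 : (C (r : ℂ)).subst (lambertX r) = C (r : ℂ) := subst_C _
  have h3 : X * derivative ℂ (X ^ r : PowerSeries ℂ) = C (r : ℂ) * X ^ r := by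
    ext d
    rw [coeff_X_mul_derivative, coeff_C_mul, coeff_X_pow]
    split_ifs with h <;> simp [h]
  rw [h1, opD_subst_lambertX hr, h3, subst_mul hs, h2]

/-- In the variable $x$ this is the eigenvalue equation of $x\,d/dx$, whose eigenspace for $r$ is
spanned by $x^r$. -/
theorem opD_eq_mul_iff (hr : 0 < r) (u : PowerSeries ℂ) :
    opD r ℂ u = C (r : ℂ) * u ↔ ∃ c : ℂ, c • lambertX r ^ r = u := by
  have hs := hasSubst_lambertX r
  constructor
  · intro h
    obtain ⟨g, rfl⟩ := exists_subst_lambertX hr u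
    have h2 : (C (r : ℂ)).subst (lambertX r) = C (r : ℂ) := subst_C _
    have h3 : X * derivative ℂ g = C (r : ℂ) * g := by
      have hinj : Function.Injective (fun f : PowerSeries ℂ => f.subst (lambertX r)) := by
        have hu : IsUnit (coeff 1 (lambertX r)) := coeff_one_lambertX hr ▸ isUnit_one
        refine Function.LeftInverse.injective
          (g := fun f : PowerSeries ℂ => PowerSeries.subst ((lambertX r).substInvOfIsUnit hu) f) fun f => ?_
        simp only
        rw [subst_comp_subst_apply hs (HasSubst.substInvOfIsUnit _ hu),
          subst_substInvOfIsUnit_right _ (constantCoeff_lambertX r), X_subst]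
      refine hinj ?_
      simp only
      rw [← opD_subst_lambertX hr, h, subst_mul hs, h2]
    refine ⟨coeff r g, ?_⟩
    have h4 : g = C (coeff r g) * X ^ r := by
      ext d
      rw [coeff_C_mul, coeff_X_pow]
      split_ifs with hd
      · rw [hd, mul_one]
      · have := congrArg (coeff d) h3
        rw [coeff_X_mul_derivative, coeff_C_mul] at this
        have hd' : (d : ℂ) - r ≠ 0 := sub_ne_zero.mpr (Nat.cast_injective.ne hd)
        rw [mul_zero]
        refine (mul_eq_zero.mp ?_).resolve_left hd'
        linear_combination this
    have h5 : (C (coeff r g)).subst (lambertX r) = C (coeff r g) := subst_C _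
    rw [h4, subst_mul hs, h5, subst_pow hs, subst_X hs, ← h4, smul_eq_C_mul]
  · rintro ⟨c, rfl⟩
    rw [smul_eq_C_mul, opD_C_mul, opD_lambertX_pow hr]
    ring

theorem opD_mul_fexp {y : PowerSeries ℂ} (hy : constantCoeff y = 0) :
    opD r ℂ (y * fexp (-(C (r : ℂ) * y))) =
      opD r ℂ y * (1 - C (r : ℂ) * y) * fexp (-(C (r : ℂ) * y)) := by
  rw [opD_mul, opD_fexp (by simp [hy]), map_neg, opD_C_mul]
  ring

/-- $D$ kills only constants and the left side has none, so the equation may be replaced by its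
image $y\,Dy-\frac1rDy+y=0$. That image is $-\frac1re^{ry}(D-r)(ye^{-ry})$, and the previous
eigenvalue equation applies. -/
theorem semiclassical_Q_iff (hr : 0 < r) {S : PowerSeries ℂ} (hS : constantCoeff S = 0) :
    (1 / 2 : ℂ) • opD r ℂ S ^ 2 - (1 / (r : ℂ)) • opD r ℂ S + S = 0 ↔
      ∃ c : ℂ, c • lambertX r ^ r = opD r ℂ S * fexp (-(C (r : ℂ) * opD r ℂ S)) := by
  have hy : constantCoeff (opD r ℂ S) = 0 := constantCoeff_opD S
  have e2 : C (1 / 2 : ℂ) * 2 = 1 := by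
    rw [show (2 : PowerSeries ℂ) = C 2 from (map_ofNat _ 2).symm, ← map_mul]
    norm_num
  have e3 : C (1 / (r : ℂ)) * C (r : ℂ) = 1 := by
    rw [← map_mul, one_div_mul_cancel (Nat.cast_ne_zero.mpr hr.ne'), map_one]
  rw [← opD_eq_mul_iff hr, opD_mul_fexp hy, smul_eq_C_mul, smul_eq_C_mul]
  set y := opD r ℂ S with hyS
  have hu := isUnit_fexp (f := -(C (r : ℂ) * y)) (by simp [hy])
  have hD : opD r ℂ (C (1 / 2 : ℂ) * y ^ 2 - C (1 / (r : ℂ)) * y + S) =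
      y * opD r ℂ y - C (1 / (r : ℂ)) * opD r ℂ y + y := by
    rw [map_add, map_sub, opD_C_mul, opD_C_mul, sq, opD_mul, ← hyS]
    linear_combination y * opD r ℂ y * e2
  have hequiv : opD r ℂ y * (1 - C (r : ℂ) * y) * fexp (-(C (r : ℂ) * y)) =
      C (r : ℂ) * (y * fexp (-(C (r : ℂ) * y))) ↔
      y * opD r ℂ y - C (1 / (r : ℂ)) * opD r ℂ y + y = 0 := by
    rw [← mul_assoc, hu.mul_left_inj]
    constructor
    · intro h
      linear_combination (-C (1 / (r : ℂ))) * h + (-y - y * opD r ℂ y) * e3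
    · intro h
      linear_combination (-C (r : ℂ)) * h - opD r ℂ y * e3
  rw [hequiv, ← hD]
  constructor
  · intro h
    rw [h, map_zero]
  · intro h
    refine eq_of_opD_eq (r := r) (by rw [h, map_zero]) ?_
    simp [hS, hy]

/-- In $(1-rz^r)DS=zS'$ the correction at $z^r$ involves only the constant term of $DS$, which is
zero. -/
theorem coeff_opD (S : PowerSeries ℂ) : coeff r (opD r ℂ S) = r * coeff r S := by
  have := congrArg (coeff r) (one_sub_mul_opD (r := r) ℂ S)
  rw [coeff_X_mul_derivative, sub_mul, one_mul, map_sub, mul_assoc, coeff_C_mul,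
    coeff_X_pow_mul', if_pos le_rfl, Nat.sub_self, coeff_zero_eq_constantCoeff_apply,
    constantCoeff_opD, mul_zero, sub_zero] at this
  exact this

/-- Solving for $y$ gives $c\,z^r$ times a series with constant term $1$. Prescribing the
coefficient of $z^r$ thus fixes the integration constant $c$. -/
theorem coeff_eq_of_smul_lambertX_pow (hr : 0 < r) {y : PowerSeries ℂ}
    (hy : constantCoeff y = 0) {c : ℂ}
    (h : c • lambertX r ^ r = y * fexp (-(C (r : ℂ) * y))) : coeff r y = c := by
  have h0 : constantCoeff (C (r : ℂ) * y) = 0 := by simp [hy]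
  have hX : constantCoeff (-(C (r : ℂ) * X ^ r)) = 0 := by simp [hr.ne']
  have h1 : y = C c * (X ^ r * (fexp (-(C (r : ℂ) * X ^ r)) * fexp (C (r : ℂ) * y))) := by
    have h2 := fexp_neg_mul_fexp h0
    rw [lambertX_pow hr, smul_eq_C_mul] at h
    linear_combination (-y) * h2 - fexp (C (r : ℂ) * y) * h
  rw [h1, coeff_C_mul, coeff_X_pow_mul', if_pos le_rfl, Nat.sub_self,
    coeff_zero_eq_constantCoeff_apply, map_mul, constantCoeff_fexp hX, constantCoeff_fexp h0,
    mul_one, mul_one]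

theorem semiclassical_Q_normalized_iff (hr : 0 < r) {S : PowerSeries ℂ}
    (hS : constantCoeff S = 0) :
    (1 / 2 : ℂ) • opD r ℂ S ^ 2 - (1 / (r : ℂ)) • opD r ℂ S + S = 0 ∧
      coeff r S = 1 / (r : ℂ) ↔ OnLambertCurve r (opD r ℂ S) := by
  have hr' : (r : ℂ) ≠ 0 := Nat.cast_ne_zero.mpr hr.ne'
  have hy : constantCoeff (opD r ℂ S) = 0 := constantCoeff_opD S
  rw [semiclassical_Q_iff hr hS, OnLambertCurve]
  constructor
  · rintro ⟨⟨c, hc⟩, h⟩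
    have := coeff_eq_of_smul_lambertX_pow hr hy hc
    rw [coeff_opD, h, mul_one_div_cancel hr'] at this
    rw [← hc, ← this, one_smul]
  · intro h
    have h1 : (1 : ℂ) • lambertX r ^ r = opD r ℂ S * fexp (-(C (r : ℂ) * opD r ℂ S)) := by
      rw [one_smul, h]
    refine ⟨⟨1, h1⟩, ?_⟩
    have := coeff_eq_of_smul_lambertX_pow hr hy h1
    rw [coeff_opD] at this
    rw [eq_div_iff hr', mul_comm, this]

/-- With $w=r(y-z^r)$ the curve reads $y=z^re^w$. Writing $e^w-1=w\,q(w)$ gives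
$(y-z^r)(1-rz^rq(w))=0$, and the second factor has constant term $1$. -/
theorem onLambertCurve_iff (hr : 0 < r) (y : PowerSeries ℂ) :
    OnLambertCurve r y ∧ constantCoeff y = 0 ↔ y = X ^ r := by
  have hX : constantCoeff (X ^ r : PowerSeries ℂ) = 0 := by simp [hr.ne']
  constructor
  · rintro ⟨h, hy⟩
    set w := C (r : ℂ) * (y - X ^ r) with hw
    have hw0 : constantCoeff w = 0 := by rw [hw, map_mul, map_sub, hy, hX, sub_zero, mul_zero]
    have hry : constantCoeff (C (r : ℂ) * y) = 0 := by rw [map_mul, hy, mul_zero]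
    have h1 : y = X ^ r * fexp w := by
      have e : fexp w = fexp (-(C (r : ℂ) * X ^ r)) * fexp (C (r : ℂ) * y) := by
        rw [← fexp_add (by rw [map_neg, map_mul, hX, mul_zero, neg_zero]) hry, hw]
        congr 1
        ring
      rw [OnLambertCurve, lambertX_pow hr] at h
      have h2 := fexp_neg_mul_fexp hry
      rw [e]
      linear_combination (-y) * h2 - fexp (C (r : ℂ) * y) * h
    obtain ⟨q, hq⟩ : X ∣ exp ℂ - 1 := X_dvd_iff.mpr (by simp)
    have h3 : fexp w = 1 + w * q.subst w := by
      have hs : HasSubst w := .of_constantCoeff_zero' hw0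
      have h4 := congrArg (fun f => f.subst w) hq
      have h5 : (1 : PowerSeries ℂ).subst w = (1 : PowerSeries ℂ) := by
        rw [← coe_substAlgHom hs, map_one]
      rw [subst_sub hs, subst_mul hs, subst_X hs, h5] at h4
      rw [fexp]
      linear_combination h4
    have h6 : (y - X ^ r) * (1 - X ^ r * C (r : ℂ) * q.subst w) = 0 := by
      rw [h3, hw] at h1
      linear_combination h1
    have h7 : (1 - X ^ r * C (r : ℂ) * q.subst w : PowerSeries ℂ) ≠ 0 := fun h8 => by
      have := congrArg constantCoeff h8
      rw [map_sub, map_mul, map_mul, hX] at this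
      simp at this
    exact sub_eq_zero.mp ((mul_eq_zero.mp h6).resolve_right h7)
  · rintro rfl
    exact ⟨lambertX_pow hr, hX⟩

end Curve

end

end OrbifoldHurwitz

namespace OrbifoldHurwitz

noncomputable section

open Equiv Equiv.Perm

/-! ### The Riemann-Hurwitz inequality -/

section Cycles

variable {X : Type*}

/-- The equivalence relation obtained from `R` by identifying the classes of `a` and `b`. -/
def joinClasses (R : Setoid X) (a b : X) : Setoid X where
  r x y := R x y ∨ ((R x a ∨ R x b) ∧ (R y a ∨ R y b))
  iseqv :=
    { refl := fun x => Or.inl (R.refl x)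
      symm := by
        rintro x y (h | ⟨h1, h2⟩)
        · exact Or.inl (R.symm h)
        · exact Or.inr ⟨h2, h1⟩
      trans := by
        rintro x y z (h | ⟨h1, h2⟩) (h' | ⟨h3, h4⟩)
        · exact Or.inl (R.trans h h')
        · exact Or.inr ⟨h3.imp (R.trans h) (R.trans h), h4⟩
        · exact Or.inr ⟨h1, h2.imp (R.trans (R.symm h')) (R.trans (R.symm h'))⟩
        · exact Or.inr ⟨h1, h4⟩ }

theorem joinClasses_apply (R : Setoid X) (a b x y : X) :
    joinClasses R a b x y ↔ R x y ∨ ((R x a ∨ R x b) ∧ (R y a ∨ R y b)) := Iff.rfl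

theorem joinClasses_eq_of_rel {R : Setoid X} {a b : X} (h : R a b) : joinClasses R a b = R := by
  ext x y
  rw [joinClasses_apply]
  refine ⟨?_, Or.inl⟩
  rintro (h' | ⟨h1, h2⟩)
  · exact h'
  · have h1' : R x b := h1.elim (fun u => R.trans u h) id
    have h2' : R y b := h2.elim (fun u => R.trans u h) id
    exact R.trans h1' (R.symm h2')

/-- The classes of `R` other than that of `b` map bijectively to the joined classes. -/
theorem card_joinClasses [Finite X] {R : Setoid X} {a b : X} (h : ¬ R a b) :
    Nat.card (Quotient R) = Nat.card (Quotient (joinClasses R a b)) + 1 := by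
  classical
  rw [← Nat.card_congr (Equiv.optionSubtypeNe (Quotient.mk R b)), Finite.card_option]
  congr 1
  let f : Quotient R → Quotient (joinClasses R a b) :=
    Quotient.map' id fun x y hxy => Or.inl hxy
  refine Nat.card_congr (Equiv.ofBijective (fun q : {q // q ≠ Quotient.mk R b} => f q) ⟨?_, ?_⟩)
  · rintro ⟨q, hq⟩ ⟨q', hq'⟩ hqq
    induction q using Quotient.inductionOn with | _ x
    induction q' using Quotient.inductionOn with | _ y
    have hx : ¬ R x b := fun hx => hq (Quotient.sound hx)
    have hy : ¬ R y b := fun hy => hq' (Quotient.sound hy)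
    have hxy : joinClasses R a b x y := Quotient.exact hqq
    refine Subtype.ext (Quotient.sound ?_)
    rcases hxy with h' | ⟨h1, h2⟩
    · exact h'
    · exact R.trans (h1.resolve_right hx) (R.symm (h2.resolve_right hy))
  · intro q
    induction q using Quotient.inductionOn with | _ x
    by_cases hx : R x b
    · refine ⟨⟨Quotient.mk R a, fun h' => h (Quotient.exact h')⟩, Quotient.sound ?_⟩
      exact Or.inr ⟨Or.inl (R.refl a), Or.inr hx⟩
    · exact ⟨⟨Quotient.mk R x, fun hxb => hx (Quotient.exact hxb)⟩, rfl⟩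

/-- The number of cycles of a permutation, fixed points included. -/
def cycleCount (σ : Perm X) : ℕ := Nat.card (Quotient (SameCycle.setoid σ))

theorem rel_of_sameCycle {σ : Perm X} {R : Setoid X} (h : ∀ x, R (σ x) x) {x y : X}
    (hxy : σ.SameCycle x y) : R x y := by
  obtain ⟨n, rfl⟩ := hxy
  refine R.symm ?_
  induction n with
  | zero => exact R.refl x
  | succ n ih =>
    rw [add_comm, zpow_add, zpow_one, mul_apply]
    exact R.trans (h _) ih
  | pred n ih =>
    refine R.trans ?_ ih
    have := h ((σ ^ (-(n : ℤ) - 1)) x)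
    rw [← mul_apply, ← zpow_one_add, show (1 + (-(n : ℤ) - 1)) = -(n : ℤ) by ring] at this
    exact R.symm this

variable [DecidableEq X] {σ : Perm X} {a b : X}

/-- From `b` the new permutation steps to `σ a`, then follows the old cycle of `a`. It meets neither
`a` nor `b` before closing up at `a`. -/
theorem sameCycle_mul_swap_of_not_sameCycle [Finite X] (h : ¬ σ.SameCycle a b) :
    (σ * swap a b).SameCycle a b := by
  classical
  have hex : ∃ k, 0 < k ∧ (σ ^ k) a = a := ⟨orderOf σ, orderOf_pos σ, by simp [pow_orderOf_eq_one]⟩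
  obtain ⟨hk, hka⟩ := Nat.find_spec hex
  set k := Nat.find hex with hkdef
  have key : ∀ j, j + 1 ≤ k → ((σ * swap a b) ^ (j + 1)) b = (σ ^ (j + 1)) a := fun j => by
    induction j with
    | zero => intro _; simp
    | succ j ih =>
      intro hj
      rw [pow_succ', mul_apply, ih (by omega), mul_apply, swap_apply_of_ne_of_ne, ← mul_apply,
        ← pow_succ']
      · intro h'
        exact Nat.find_min hex (show j + 1 < k by omega) ⟨by omega, h'⟩
      · intro h'
        exact h ⟨(j + 1 : ℕ), by rw [zpow_natCast, h']⟩
  obtain ⟨j, hj⟩ : ∃ j, k = j + 1 := ⟨k - 1, by omega⟩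
  refine SameCycle.symm ⟨(k : ℕ), ?_⟩
  rw [zpow_natCast, hj, key j hj.ge, ← hj, hka]

/-- With `k` the first positive time at which `σ` carries `a` to `b`, the new orbit of `b` stays
among $\sigma a,\dots,\sigma^ka=b$, and this arc avoids `a`. -/
theorem not_sameCycle_mul_swap_of_sameCycle [Finite X] (hab : a ≠ b) (h : σ.SameCycle a b) :
    ¬ (σ * swap a b).SameCycle a b := by
  classical
  have hex : ∃ k, 0 < k ∧ (σ ^ k) a = b := by
    obtain ⟨n, -, hb⟩ := h.exists_pow_eq'
    refine ⟨n, Nat.pos_of_ne_zero ?_, hb⟩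
    rintro rfl
    exact hab (by simpa using hb)
  obtain ⟨hk, hka⟩ := Nat.find_spec hex
  set k := Nat.find hex with hkdef
  have hmin : ∀ j, 0 < j → j < k → (σ ^ j) a ≠ b := fun j h0 hj h' =>
    Nat.find_min hex hj ⟨h0, h'⟩
  have hna : ∀ j, 0 < j → j ≤ k → (σ ^ j) a ≠ a := fun j h0 hj h' => by
    rcases hj.lt_or_eq with hlt | heq
    · refine hmin (k - j) (by omega) (by omega) ?_
      rw [← hka]
      conv_rhs => rw [show k = (k - j) + j by omega, pow_add, mul_apply, h']
    · exact hab (by rw [← h', heq, hka])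
  have key : ∀ n : ℕ, ∃ j, 0 < j ∧ j ≤ k ∧ ((σ * swap a b) ^ n) b = (σ ^ j) a := fun n => by
    induction n with
    | zero => exact ⟨k, hk, le_rfl, by simp [hka]⟩
    | succ n ih =>
      obtain ⟨j, h0, hj, e⟩ := ih
      rw [pow_succ', mul_apply, e]
      rcases hj.lt_or_eq with hlt | heq
      · refine ⟨j + 1, by omega, by omega, ?_⟩
        rw [mul_apply, swap_apply_of_ne_of_ne (hna j h0 hj) (hmin j h0 hlt), ← mul_apply,
          ← pow_succ']
      · refine ⟨1, one_pos, by omega, ?_⟩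
        rw [heq, hka]
        simp
  intro h'
  obtain ⟨n, -, hn⟩ := h'.symm.exists_pow_eq'
  obtain ⟨j, h0, hj, e⟩ := key n
  exact hna j h0 hj (by rw [← e, hn])

theorem setoid_mul_swap [Finite X] (h : ¬ σ.SameCycle a b) :
    SameCycle.setoid (σ * swap a b) = joinClasses (SameCycle.setoid σ) a b := by
  have hab := sameCycle_mul_swap_of_not_sameCycle h
  refine le_antisymm (fun {x y} hxy => ?_) (fun {x y} hxy => ?_)
  · refine rel_of_sameCycle (σ := σ * swap a b) (R := joinClasses (SameCycle.setoid σ) a b)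
      (fun x => ?_) hxy
    have hσ : ∀ z, (SameCycle.setoid σ) (σ z) z := fun z => sameCycle_apply_left.mpr (.refl σ z)
    rw [mul_apply, joinClasses_apply]
    by_cases hxa : x = a
    · subst hxa
      rw [swap_apply_left]
      exact Or.inr ⟨Or.inr (hσ b), Or.inl (SameCycle.refl σ _)⟩
    · by_cases hxb : x = b
      · subst hxb
        rw [swap_apply_right]
        exact Or.inr ⟨Or.inl (hσ a), Or.inr (SameCycle.refl σ _)⟩
      · rw [swap_apply_of_ne_of_ne hxa hxb]
        exact Or.inl (hσ x)
  · have hσ : ∀ z w, σ.SameCycle z w → (σ * swap a b).SameCycle z w := fun z w hzw => by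
      refine rel_of_sameCycle (R := SameCycle.setoid (σ * swap a b)) (fun x => ?_) hzw
      change (σ * swap a b).SameCycle (σ x) x
      have hstep : ∀ z, (σ * swap a b).SameCycle ((σ * swap a b) z) z := fun z =>
        sameCycle_apply_left.mpr (.refl _ z)
      by_cases hxa : x = a
      · subst hxa
        have := hstep b
        rw [mul_apply, swap_apply_right] at this
        exact this.trans hab.symm
      · by_cases hxb : x = b
        · subst hxb
          have := hstep a
          rw [mul_apply, swap_apply_left] at this
          exact this.trans hab
        · have := hstep x
          rwa [mul_apply, swap_apply_of_ne_of_ne hxa hxb] at this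
    rcases hxy with h' | ⟨h1, h2⟩
    · exact hσ _ _ h'
    · have h1' : (σ * swap a b).SameCycle x b :=
        h1.elim (fun u => (hσ _ _ u).trans hab) (hσ _ _)
      have h2' : (σ * swap a b).SameCycle y b :=
        h2.elim (fun u => (hσ _ _ u).trans hab) (hσ _ _)
      exact h1'.trans h2'.symm

theorem cycleCount_mul_swap_of_not_sameCycle [Finite X] (h : ¬ σ.SameCycle a b) :
    cycleCount σ = cycleCount (σ * swap a b) + 1 := by
  rw [cycleCount, card_joinClasses (R := SameCycle.setoid σ) h, cycleCount, setoid_mul_swap h]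

theorem cycleCount_mul_swap_of_sameCycle [Finite X] (hab : a ≠ b) (h : σ.SameCycle a b) :
    cycleCount (σ * swap a b) = cycleCount σ + 1 := by
  have := cycleCount_mul_swap_of_not_sameCycle (not_sameCycle_mul_swap_of_sameCycle hab h)
  rwa [mul_assoc, swap_mul_self, mul_one] at this

end Cycles

/-! ### The genus bound and its parity, from cycle counts -/

section RiemannHurwitz

variable {X : Type*} [Finite X]

/-- Induction on the transpositions, with `R` built up by joining classes. Each transposition
changes the number of cycles of the product by one, which gives the parity. -/
theorem exists_setoid_cycleCount_le [DecidableEq X] (α : Perm X) (l : List (Perm X))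
    (hl : ∀ τ ∈ l, τ.IsSwap) :
    ∃ R : Setoid X, (∀ x, R (α x) x) ∧ (∀ τ ∈ l, ∀ x, R (τ x) x) ∧
      cycleCount (α * l.prod) + cycleCount α ≤ 2 * Nat.card (Quotient R) + l.length ∧
      Even (cycleCount (α * l.prod) + cycleCount α + l.length) := by
  induction l using List.reverseRecOn with
  | nil =>
    refine ⟨SameCycle.setoid α, fun x => sameCycle_apply_left.mpr (.refl α x), by simp, ?_, ?_⟩
    · simp [cycleCount, two_mul]
    · simp
  | append_singleton l τ ih =>
    obtain ⟨R, h1, h2, h3, h4⟩ := ih fun τ hτ => hl τ (by simp [hτ])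
    obtain ⟨a, b, hab, rfl⟩ := hl τ (by simp)
    have hprod : α * (l ++ [swap a b]).prod = α * l.prod * swap a b := by simp [mul_assoc]
    have hR : ∀ x, R ((α * l.prod) x) x := fun x => by
      rw [mul_apply]
      refine R.trans (h1 _) ?_
      clear h3 h4 hprod hl ih
      induction l with
      | nil => exact R.refl x
      | cons τ l ih =>
        rw [List.prod_cons, mul_apply]
        exact R.trans (h2 τ (by simp) _) (ih fun τ hτ => h2 τ (by simp [hτ]))
    refine ⟨joinClasses R a b, fun x => Or.inl (h1 x), ?_, ?_, ?_⟩
    · intro τ hτ x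
      rw [List.mem_append, List.mem_singleton] at hτ
      rcases hτ with hτ | rfl
      · exact Or.inl (h2 τ hτ x)
      · by_cases hxa : x = a
        · subst hxa
          rw [swap_apply_left]
          exact Or.inr ⟨Or.inr (R.refl b), Or.inl (R.refl x)⟩
        · by_cases hxb : x = b
          · subst hxb
            rw [swap_apply_right]
            exact Or.inr ⟨Or.inl (R.refl a), Or.inr (R.refl x)⟩
          · rw [swap_apply_of_ne_of_ne hxa hxb]
    · rw [hprod, List.length_append, List.length_singleton]
      -- If `a` and `b` are already related, the cycle count rises by at most one, paid for by the
      -- length. Otherwise they lie in different cycles: the left side drops by one, and the right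
      -- side by two for the lost class, plus one for the length.
      by_cases hRab : R a b
      · rw [joinClasses_eq_of_rel hRab]
        by_cases hs : (α * l.prod).SameCycle a b
        · rw [cycleCount_mul_swap_of_sameCycle hab hs]
          omega
        · have := cycleCount_mul_swap_of_not_sameCycle hs
          omega
      · have hs : ¬ (α * l.prod).SameCycle a b := fun hs => hRab (rel_of_sameCycle hR hs)
        have := cycleCount_mul_swap_of_not_sameCycle hs
        have := card_joinClasses hRab
        omega
    · rw [hprod, List.length_append, List.length_singleton]
      by_cases hs : (α * l.prod).SameCycle a b
      · rw [cycleCount_mul_swap_of_sameCycle hab hs]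
        obtain ⟨q, hq⟩ := h4
        exact ⟨q + 1, by omega⟩
      · have := cycleCount_mul_swap_of_not_sameCycle hs
        obtain ⟨q, hq⟩ := h4
        exact ⟨q, by omega⟩

/-- Connectedness of a covering in terms of its monodromy: a nonempty set of sheets that is
invariant under the monodromy contains all sheets. -/
def IsConnectedCover {X I : Type*} (α : Perm X) (τ : I → Perm X) : Prop :=
  ∀ A : Set X, A.Nonempty → (∀ x, α x ∈ A ↔ x ∈ A) → (∀ i x, τ i x ∈ A ↔ x ∈ A) → A = Set.univ

/-- Invariance of a set under generators passes to the group they generate; conversely, an orbit is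
an invariant set. -/
theorem isPretransitive_closure_iff {X I : Type*} (α : Perm X) (τ : I → Perm X) :
    MulAction.IsPretransitive (Subgroup.closure (insert α (Set.range τ))) X ↔
      IsConnectedCover α τ := by
  constructor
  · intro h A ⟨x, hx⟩ hα hτ
    refine Set.eq_univ_of_forall fun y => ?_
    obtain ⟨⟨g, hg⟩, hgx⟩ := MulAction.exists_smul_eq
      (Subgroup.closure (insert α (Set.range τ))) x y
    have hgx' : g x = y := hgx
    have key : ∀ z, g z ∈ A ↔ z ∈ A := by
      clear hgx hgx'
      induction hg using Subgroup.closure_induction with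
      | mem g hg =>
        rcases hg with rfl | ⟨i, rfl⟩
        · exact hα
        · exact hτ i
      | one => simp
      | mul g g' _ _ h1 h2 => intro z; rw [mul_apply, h1, h2]
      | inv g _ h1 => intro z; rw [← h1, ← mul_apply, mul_inv_cancel, one_apply]
    rw [← hgx', key]
    exact hx
  · intro h
    refine ⟨fun x y => ?_⟩
    have hstep : ∀ g ∈ insert α (Set.range τ), ∀ z,
        g z ∈ MulAction.orbit (Subgroup.closure (insert α (Set.range τ))) x ↔
          z ∈ MulAction.orbit (Subgroup.closure (insert α (Set.range τ))) x := fun g hg z => by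
      rw [← MulAction.orbit_eq_iff, ← MulAction.orbit_eq_iff]
      have : g z = (⟨g, Subgroup.subset_closure hg⟩ :
        Subgroup.closure (insert α (Set.range τ))) • z := rfl
      rw [this, MulAction.orbit_smul]
    have := h _ ⟨x, MulAction.mem_orbit_self x⟩ (hstep α (Set.mem_insert _ _))
      fun i => hstep _ (Set.mem_insert_of_mem _ ⟨i, rfl⟩)
    have hy : y ∈ MulAction.orbit (Subgroup.closure (insert α (Set.range τ))) x := by
      rw [this]; trivial
    exact hy

/-- The genus of a connected covering is a nonnegative integer. -/
theorem cycleCount_add_le {s : ℕ} {α : Perm X} {τ : Fin s → Perm X} [Nonempty X] [DecidableEq X]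
    (hτ : ∀ i, (τ i).IsSwap) (hc : IsConnectedCover α τ) :
    cycleCount (α * (List.ofFn τ).prod) + cycleCount α ≤ s + 2 ∧
      Even (cycleCount (α * (List.ofFn τ).prod) + cycleCount α + s) := by
  obtain ⟨R, h1, h2, h3, h4⟩ := exists_setoid_cycleCount_le α (List.ofFn τ) (by
    intro t ht
    obtain ⟨i, rfl⟩ := (List.mem_ofFn' _ _).mp ht
    exact hτ i)
  rw [List.length_ofFn] at h3 h4
  refine ⟨?_, h4⟩
  have hall : ∀ x y, R x y := fun x y => by
    have := hc {z | R z y} ⟨y, R.refl y⟩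
      (fun z => ⟨fun h => R.trans (R.symm (h1 z)) h, fun h => R.trans (h1 z) h⟩)
      (fun i z => by
        have h2' := h2 (τ i) ((List.mem_ofFn' _ _).mpr ⟨i, rfl⟩) z
        exact ⟨fun h => R.trans (R.symm h2') h, fun h => R.trans h2' h⟩)
    exact Set.eq_univ_iff_forall.mp this x
  have : Subsingleton (Quotient R) := ⟨fun q q' =>
    Quotient.inductionOn₂ q q' fun x y => Quotient.sound (hall x y)⟩
  have := Finite.card_le_one_iff_subsingleton.mpr this
  omega

theorem cycleCount_pos [Nonempty X] (σ : Perm X) : 0 < cycleCount σ := by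
  have : Nonempty (Quotient (SameCycle.setoid σ)) := ⟨Quotient.mk _ (Classical.arbitrary X)⟩
  exact Nat.card_pos

theorem card_sameCycle (α : Perm X) (y : X) :
    Nat.card {x // α.SameCycle x y} = Function.minimalPeriod α y := by
  have := Fintype.ofFinite (MulAction.orbit (Subgroup.zpowers α) y)
  have h : Function.minimalPeriod α y = Function.minimalPeriod (α • ·) y := rfl
  rw [h, MulAction.minimalPeriod_eq_card, ← Nat.card_eq_fintype_card]
  refine Nat.card_congr (Equiv.subtypeEquivRight fun x => ?_)
  constructor
  · intro hx
    obtain ⟨n, hn⟩ := hx.symm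
    exact ⟨⟨α ^ n, n, rfl⟩, hn⟩
  · rintro ⟨⟨_, n, rfl⟩, hn⟩
    exact SameCycle.symm ⟨n, hn⟩

theorem card_eq_mul_cycleCount {r : ℕ} {α : Perm X}
    (h : ∀ x, Function.minimalPeriod α x = r) : Nat.card X = r * cycleCount α := by
  have hfib : ∀ q : Quotient (SameCycle.setoid α),
      Nat.card {x // Quotient.mk (SameCycle.setoid α) x = q} = r := fun q => by
    induction q using Quotient.inductionOn with | _ y
    rw [← h y, ← card_sameCycle]
    exact Nat.card_congr (Equiv.subtypeEquivRight fun x => Quotient.eq)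
  have := Fintype.ofFinite (Quotient (SameCycle.setoid α))
  rw [← Nat.card_congr (Equiv.sigmaFiberEquiv (Quotient.mk (SameCycle.setoid α))), Nat.card_sigma]
  simp_rw [hfib]
  rw [Finset.sum_const, Finset.card_univ, ← Nat.card_eq_fintype_card, smul_eq_mul, mul_comm,
    cycleCount]

end RiemannHurwitz

end

end OrbifoldHurwitz

namespace OrbifoldHurwitz

noncomputable section

open Equiv Equiv.Perm

/-! ### Decomposition of coverings into connected components -/

theorem minimalPeriod_of_injective {X Y : Type*} {f : X → X} {g : Y → Y} {ι : X → Y}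
    (hι : Function.Injective ι) (h : ∀ x, ι (f x) = g (ι x)) (x : X) :
    Function.minimalPeriod g (ι x) = Function.minimalPeriod f x := by
  rw [Function.minimalPeriod_eq_minimalPeriod_iff]
  intro n
  have : g^[n] (ι x) = ι (f^[n] x) := by
    induction n with
    | zero => rfl
    | succ n ih => rw [Function.iterate_succ_apply', Function.iterate_succ_apply', ih, h]
  rw [Function.IsPeriodicPt, Function.IsFixedPt, this, hι.eq_iff]
  rfl

/-- Monodromy data of a not necessarily connected covering with sheets `X`, whose simple
branch points are indexed by `I`. -/
structure IsCover (r : ℕ) {X I : Type*} [DecidableEq X] (α : Perm X) (τ : I → Perm X) : Prop where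
  zeros : ∀ x, Function.minimalPeriod α x = r
  simple : ∀ i, (τ i).IsSwap

/-- The number of coverings with sheets `X` and simple branch points `I`. -/
def coverCount (r : ℕ) (X I : Type*) [DecidableEq X] : ℕ :=
  Nat.card {c : Perm X × (I → Perm X) // IsCover r c.1 c.2}

/-- The number of connected coverings with sheets `X` and simple branch points `I`. -/
def connectedCount (r : ℕ) (X I : Type*) [DecidableEq X] : ℕ :=
  Nat.card {c : Perm X × (I → Perm X) // IsCover r c.1 c.2 ∧ IsConnectedCover c.1 c.2}

/-! ### Independence of the names of sheets and branch points -/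

section Congr

variable {r : ℕ} {X Y I J : Type*}

/-- Transport of monodromy data along bijections of sheets and of branch points. -/
def dataCongr (e : X ≃ Y) (f : I ≃ J) :
    Perm X × (I → Perm X) ≃ Perm Y × (J → Perm Y) :=
  Equiv.prodCongr e.permCongr (Equiv.arrowCongr f e.permCongr)

theorem isConnectedCover_dataCongr (e : X ≃ Y) (f : I ≃ J) (c : Perm X × (I → Perm X))
    (h : IsConnectedCover c.1 c.2) :
    IsConnectedCover (dataCongr e f c).1 (dataCongr e f c).2 := by
  intro A hA h1 h2
  have := h (e ⁻¹' A) (hA.preimage e.surjective)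
    (fun x => by
      have := h1 (e x)
      simpa [dataCongr, permCongr_apply] using this)
    (fun i x => by
      have := h2 (f i) (e x)
      simpa [dataCongr, permCongr_apply, Equiv.arrowCongr_apply] using this)
  refine Set.eq_univ_of_forall (e.surjective.forall.mpr fun x => ?_)
  exact Set.eq_univ_iff_forall.mp this x

variable [DecidableEq X] [DecidableEq Y]

theorem isSwap_permCongr (e : X ≃ Y) (σ : Perm X) : (e.permCongr σ).IsSwap ↔ σ.IsSwap := by
  constructor
  · rintro ⟨a, b, hab, h⟩
    refine ⟨e.symm a, e.symm b, e.symm.injective.ne hab, ?_⟩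
    apply e.permCongr.injective
    rw [h, permCongr_def, Equiv.symm_trans_swap_trans]
    simp
  · rintro ⟨a, b, hab, rfl⟩
    exact ⟨e a, e b, e.injective.ne hab, by rw [permCongr_def, Equiv.symm_trans_swap_trans]⟩

theorem isCover_dataCongr (e : X ≃ Y) (f : I ≃ J) (c : Perm X × (I → Perm X)) :
    IsCover r c.1 c.2 ↔ IsCover r (dataCongr e f c).1 (dataCongr e f c).2 := by
  have h1 : ∀ x, Function.minimalPeriod (dataCongr e f c).1 (e x) =
      Function.minimalPeriod c.1 x := fun x =>
    minimalPeriod_of_injective e.injective (fun z => by simp [dataCongr, permCongr_apply]) x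
  have h2 : ∀ i, ((dataCongr e f c).2 (f i)).IsSwap ↔ (c.2 i).IsSwap := fun i => by
    rw [← isSwap_permCongr e (c.2 i)]
    simp [dataCongr, Equiv.arrowCongr_apply]
  constructor
  · rintro ⟨hz, hs⟩
    exact ⟨e.surjective.forall.mpr fun x => by rw [h1, hz],
      f.surjective.forall.mpr fun i => (h2 i).mpr (hs i)⟩
  · rintro ⟨hz, hs⟩
    exact ⟨fun x => by rw [← h1, hz], fun i => (h2 i).mp (hs _)⟩

theorem coverCount_congr (e : X ≃ Y) (f : I ≃ J) : coverCount r X I = coverCount r Y J :=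
  Nat.card_congr (Equiv.subtypeEquiv (dataCongr e f) (isCover_dataCongr e f))

theorem connectedCount_congr (e : X ≃ Y) (f : I ≃ J) :
    connectedCount r X I = connectedCount r Y J := by
  refine Nat.card_congr (Equiv.subtypeEquiv (dataCongr e f) fun c => ?_)
  rw [← isCover_dataCongr e f]
  refine and_congr_right fun _ => ⟨isConnectedCover_dataCongr e f c, fun h => ?_⟩
  have h' := isConnectedCover_dataCongr e.symm f.symm _ h
  have hc : dataCongr e.symm f.symm (dataCongr e f c) = c := (dataCongr e f).symm_apply_apply c
  rwa [hc] at h'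

end Congr

section Component

variable {X I : Type*}

/-- The sheets of the connected component of the sheet `x`. -/
def component (c : Perm X × (I → Perm X)) (x : X) : Set X :=
  {y | ∀ A : Set X, x ∈ A → (∀ z, c.1 z ∈ A ↔ z ∈ A) → (∀ i z, c.2 i z ∈ A ↔ z ∈ A) → y ∈ A}

theorem mem_component_self (c : Perm X × (I → Perm X)) (x : X) : x ∈ component c x :=
  fun _ h _ _ => h

theorem fst_mem_component (c : Perm X × (I → Perm X)) (x z : X) :
    c.1 z ∈ component c x ↔ z ∈ component c x :=
  ⟨fun h A hA h1 h2 => (h1 z).mp (h A hA h1 h2), fun h A hA h1 h2 => (h1 z).mpr (h A hA h1 h2)⟩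

theorem snd_mem_component (c : Perm X × (I → Perm X)) (x : X) (i : I) (z : X) :
    c.2 i z ∈ component c x ↔ z ∈ component c x :=
  ⟨fun h A hA h1 h2 => (h2 i z).mp (h A hA h1 h2), fun h A hA h1 h2 => (h2 i z).mpr (h A hA h1 h2)⟩

/-- The branch points of the part of a covering with sheets `A`. -/
def branchPoints (c : Perm X × (I → Perm X)) (A : Set X) : Set I :=
  {i | ∃ x ∈ A, c.2 i x ≠ x}

end Component

/-! ### Splitting off the component of a chosen sheet -/

section Glue

variable {r : ℕ} {X I : Type*} [DecidableEq X] [DecidableEq I]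

/-- The disjoint union of a covering with sheets `A` and branch points `B` and one with
the complementary sheets and branch points. -/
def glue (A : Finset X) (B : Finset I)
    (c : Perm {x // x ∈ A} × ({i // i ∈ B} → Perm {x // x ∈ A}))
    (c' : Perm {x // ¬ x ∈ A} × ({i // ¬ i ∈ B} → Perm {x // ¬ x ∈ A})) :
    Perm X × (I → Perm X) :=
  ⟨c.1.subtypeCongr c'.1, fun i => if h : i ∈ B then (c.2 ⟨i, h⟩).subtypeCongr 1 else
    Perm.subtypeCongr 1 (c'.2 ⟨i, h⟩)⟩

variable {A : Finset X} {B : Finset I}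
  {c : Perm {x // x ∈ A} × ({i // i ∈ B} → Perm {x // x ∈ A})}
  {c' : Perm {x // ¬ x ∈ A} × ({i // ¬ i ∈ B} → Perm {x // ¬ x ∈ A})}

theorem glue_fst_left (x : {x // x ∈ A}) : (glue A B c c').1 x = c.1 x :=
  Perm.subtypeCongr.left_apply_subtype _ _ x

theorem glue_fst_right (x : {x // ¬ x ∈ A}) : (glue A B c c').1 x = c'.1 x :=
  Perm.subtypeCongr.right_apply_subtype _ _ x

theorem glue_snd_left_left (i : {i // i ∈ B}) (x : {x // x ∈ A}) :
    (glue A B c c').2 i x = c.2 i x := by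
  simp [glue]

theorem glue_snd_left_right (i : {i // i ∈ B}) (x : {x // ¬ x ∈ A}) :
    (glue A B c c').2 i x = x := by
  simp only [glue, i.2, dite_true]
  exact Perm.subtypeCongr.right_apply_subtype _ _ x

theorem glue_snd_right_left (i : {i // ¬ i ∈ B}) (x : {x // x ∈ A}) :
    (glue A B c c').2 i x = x := by
  simp only [glue, i.2, dite_false]
  exact Perm.subtypeCongr.left_apply_subtype _ _ x

theorem glue_snd_right_right (i : {i // ¬ i ∈ B}) (x : {x // ¬ x ∈ A}) :
    (glue A B c c').2 i x = c'.2 i x := by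
  simp only [glue, i.2, dite_false]
  exact Perm.subtypeCongr.right_apply_subtype _ _ x

theorem isSwap_of_subtype {p : X → Prop} {σ : Perm X} {ρ : Perm {x // p x}}
    (h : ∀ x : {x // p x}, σ x = ρ x) (h' : ∀ x, ¬ p x → σ x = x) : σ.IsSwap ↔ ρ.IsSwap := by
  constructor
  · rintro ⟨a, b, hab, rfl⟩
    have ha : p a := by
      by_contra ha
      exact hab (by simpa using (h' a ha).symm)
    have hb : p b := by
      by_contra hb
      exact hab (by simpa using h' b hb)
    refine ⟨⟨a, ha⟩, ⟨b, hb⟩, by simpa using hab, ?_⟩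
    ext x
    rw [← h x, swap_apply_def, swap_apply_def]
    simp only [Subtype.ext_iff]
    split_ifs <;> rfl
  · rintro ⟨a, b, hab, rfl⟩
    refine ⟨a, b, Subtype.coe_injective.ne hab, ?_⟩
    ext x
    by_cases hx : p x
    · rw [h ⟨x, hx⟩, swap_apply_def, swap_apply_def]
      simp only [Subtype.ext_iff]
      split_ifs <;> rfl
    · rw [h' x hx, swap_apply_of_ne_of_ne]
      · rintro rfl; exact hx a.2
      · rintro rfl; exact hx b.2

theorem isCover_glue : IsCover r (glue A B c c').1 (glue A B c c').2 ↔
    IsCover r c.1 c.2 ∧ IsCover r c'.1 c'.2 := by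
  have h1 : ∀ x : {x // x ∈ A}, Function.minimalPeriod (glue A B c c').1 x =
      Function.minimalPeriod c.1 x := fun x =>
    minimalPeriod_of_injective Subtype.coe_injective (fun z => (glue_fst_left z).symm) x
  have h2 : ∀ x : {x // ¬ x ∈ A}, Function.minimalPeriod (glue A B c c').1 x =
      Function.minimalPeriod c'.1 x := fun x =>
    minimalPeriod_of_injective Subtype.coe_injective (fun z => (glue_fst_right z).symm) x
  have h3 : ∀ i : {i // i ∈ B}, ((glue A B c c').2 i).IsSwap ↔ (c.2 i).IsSwap := fun i =>
    isSwap_of_subtype (glue_snd_left_left i) fun x hx => glue_snd_left_right i ⟨x, hx⟩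
  have h4 : ∀ i : {i // ¬ i ∈ B}, ((glue A B c c').2 i).IsSwap ↔ (c'.2 i).IsSwap := fun i =>
    isSwap_of_subtype (glue_snd_right_right i)
      fun x hx => glue_snd_right_left i ⟨x, not_not.mp hx⟩
  constructor
  · rintro ⟨hz, hs⟩
    exact ⟨⟨fun x => by rw [← h1, hz], fun i => (h3 i).mp (hs i)⟩,
      ⟨fun x => by rw [← h2, hz], fun i => (h4 i).mp (hs i)⟩⟩
  · rintro ⟨⟨hz, hs⟩, ⟨hz', hs'⟩⟩
    refine ⟨fun x => ?_, fun i => ?_⟩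
    · by_cases hx : x ∈ A
      · exact (h1 ⟨x, hx⟩).trans (hz _)
      · exact (h2 ⟨x, hx⟩).trans (hz' _)
    · by_cases hi : i ∈ B
      · exact (h3 ⟨i, hi⟩).mpr (hs _)
      · exact (h4 ⟨i, hi⟩).mpr (hs' _)

theorem glue_injective : Function.Injective (fun p :
    (Perm {x // x ∈ A} × ({i // i ∈ B} → Perm {x // x ∈ A})) ×
    (Perm {x // ¬ x ∈ A} × ({i // ¬ i ∈ B} → Perm {x // ¬ x ∈ A})) => glue A B p.1 p.2) := by
  rintro ⟨c₁, c₁'⟩ ⟨c₂, c₂'⟩ h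
  simp only at h
  refine Prod.ext (Prod.ext ?_ ?_) (Prod.ext ?_ ?_)
  · ext x
    exact (glue_fst_left x).symm.trans ((congrArg (fun c => c.1 (x : X)) h).trans (glue_fst_left x))
  · ext i x
    exact (glue_snd_left_left i x).symm.trans
      ((congrArg (fun c => c.2 i (x : X)) h).trans (glue_snd_left_left i x))
  · ext x
    exact (glue_fst_right x).symm.trans
      ((congrArg (fun c => c.1 (x : X)) h).trans (glue_fst_right x))
  · ext i x
    exact (glue_snd_right_right i x).symm.trans
      ((congrArg (fun c => c.2 i (x : X)) h).trans (glue_snd_right_right i x))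

theorem component_glue {x : X} (hx : x ∈ A) :
    component (glue A B c c') x = A ↔ IsConnectedCover c.1 c.2 := by
  have hA1 : ∀ z, (glue A B c c').1 z ∈ (A : Set X) ↔ z ∈ (A : Set X) := fun z => by
    by_cases hz : z ∈ A
    · rw [show z = ((⟨z, hz⟩ : {x // x ∈ A}) : X) from rfl, glue_fst_left]
      exact iff_of_true (Subtype.prop _) hz
    · rw [show z = ((⟨z, hz⟩ : {x // ¬ x ∈ A}) : X) from rfl, glue_fst_right]
      exact iff_of_false (c'.1 ⟨z, hz⟩).2 hz
  have hA2 : ∀ i z, (glue A B c c').2 i z ∈ (A : Set X) ↔ z ∈ (A : Set X) := fun i z => by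
    by_cases hi : i ∈ B
    · by_cases hz : z ∈ A
      · have := glue_snd_left_left (c := c) (c' := c') ⟨i, hi⟩ ⟨z, hz⟩
        simp only at this
        rw [this]
        exact iff_of_true (Subtype.prop _) hz
      · have := glue_snd_left_right (c := c) (c' := c') ⟨i, hi⟩ ⟨z, hz⟩
        simp only at this
        rw [this]
    · by_cases hz : z ∈ A
      · have := glue_snd_right_left (c := c) (c' := c') ⟨i, hi⟩ ⟨z, hz⟩
        simp only at this
        rw [this]
      · have := glue_snd_right_right (c := c) (c' := c') ⟨i, hi⟩ ⟨z, hz⟩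
        simp only at this
        rw [this]
        exact iff_of_false (c'.2 ⟨i, hi⟩ ⟨z, hz⟩).2 hz
  constructor
  · intro h U hU h1 h2
    -- an invariant subset of `A` containing `x` is all of `A`
    have key : ∀ V : Set {x // x ∈ A}, (⟨x, hx⟩ : {x // x ∈ A}) ∈ V →
        (∀ z, c.1 z ∈ V ↔ z ∈ V) → (∀ i z, c.2 i z ∈ V ↔ z ∈ V) → V = Set.univ := by
      intro V hxV hV1 hV2
      refine Set.eq_univ_of_forall fun y => ?_
      have hy : (y : X) ∈ component (glue A B c c') x := by rw [h]; exact y.2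
      have := hy {z | ∃ hz : z ∈ A, (⟨z, hz⟩ : {x // x ∈ A}) ∈ V} ⟨hx, hxV⟩
        (fun z => by
          by_cases hz : z ∈ A
          · have e := glue_fst_left (B := B) (c := c) (c' := c') ⟨z, hz⟩
            simp only at e
            exact ⟨fun ⟨_, hv⟩ => ⟨hz, (hV1 ⟨z, hz⟩).mp (by simpa [e] using hv)⟩,
              fun ⟨_, hv⟩ => ⟨by rw [e]; exact (c.1 ⟨z, hz⟩).2,
                by simpa [e] using (hV1 ⟨z, hz⟩).mpr hv⟩⟩
          · have := hA1 z
            simp only [Finset.mem_coe] at this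
            exact iff_of_false (fun h => hz (this.mp h.1)) (fun h => hz h.1))
        (fun i z => by
          by_cases hz : z ∈ A
          · by_cases hi : i ∈ B
            · have e := glue_snd_left_left (c := c) (c' := c') ⟨i, hi⟩ ⟨z, hz⟩
              simp only at e
              exact ⟨fun ⟨_, hv⟩ => ⟨hz, (hV2 ⟨i, hi⟩ ⟨z, hz⟩).mp (by simpa [e] using hv)⟩,
                fun ⟨_, hv⟩ => ⟨by rw [e]; exact (c.2 ⟨i, hi⟩ ⟨z, hz⟩).2,
                  by simpa [e] using (hV2 ⟨i, hi⟩ ⟨z, hz⟩).mpr hv⟩⟩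
            · have e := glue_snd_right_left (c := c) (c' := c') ⟨i, hi⟩ ⟨z, hz⟩
              simp only at e
              simp only [e]
          · have := hA2 i z
            simp only [Finset.mem_coe] at this
            exact iff_of_false (fun h => hz (this.mp h.1)) (fun h => hz h.1))
      exact this.2
    -- Complements of invariant sets are invariant. If `U` misses `x`, its complement is everything,
    -- against `U` being nonempty.
    by_cases hxU : (⟨x, hx⟩ : {x // x ∈ A}) ∈ U
    · exact key U hxU h1 h2
    · have := key Uᶜ hxU (fun z => not_congr (h1 z)) (fun i z => not_congr (h2 i z))
      obtain ⟨u, hu⟩ := hU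
      exact absurd hu (Set.eq_univ_iff_forall.mp this u)
  · intro h
    refine subset_antisymm (fun y hy => hy A hx hA1 hA2) fun y hy V hxV hV1 hV2 => ?_
    have := h (Subtype.val ⁻¹' V) ⟨⟨x, hx⟩, hxV⟩
      (fun z => by
        rw [Set.mem_preimage, ← glue_fst_left (B := B) (c' := c')]
        exact hV1 z)
      (fun i z => by
        rw [Set.mem_preimage, ← glue_snd_left_left (c' := c')]
        exact hV2 i z)
    exact Set.eq_univ_iff_forall.mp this ⟨y, hy⟩

theorem branchPoints_glue (hc : ∀ i, (c.2 i).IsSwap) :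
    branchPoints (glue A B c c') A = B := by
  ext i
  constructor
  · rintro ⟨x, hx, hne⟩
    by_contra hi
    exact hne (glue_snd_right_left ⟨i, hi⟩ ⟨x, hx⟩)
  · intro hi
    obtain ⟨a, b, hab, h⟩ := hc ⟨i, hi⟩
    refine ⟨a, a.2, ?_⟩
    have := glue_snd_left_left (c := c) (c' := c') ⟨i, hi⟩ a
    simp only at this
    rw [this, h, swap_apply_left]
    exact fun h' => hab (Subtype.ext h'.symm)

/-- A transposition that preserves `A` and moves a sheet of `A` exchanges two sheets of `A`, so it
is trivial off `A`. Hence each branch point belongs to exactly one of the two pieces. -/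
theorem exists_glue (C : Perm X × (I → Perm X)) (h2 : ∀ i, (C.2 i).IsSwap)
    (hA1 : ∀ z, C.1 z ∈ A ↔ z ∈ A) (hA2 : ∀ i z, C.2 i z ∈ A ↔ z ∈ A)
    (hB : ∀ i, i ∈ B ↔ ∃ x ∈ A, C.2 i x ≠ x) : ∃ c c', glue A B c c' = C := by
  refine ⟨⟨C.1.subtypePerm hA1, fun i => (C.2 i).subtypePerm (hA2 i)⟩,
    ⟨C.1.subtypePerm fun z => not_congr (hA1 z),
      fun i => (C.2 i).subtypePerm fun z => not_congr (hA2 i z)⟩, ?_⟩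
  refine Prod.ext ?_ (funext fun i => ?_)
  · ext x
    by_cases hx : x ∈ A
    · exact glue_fst_left ⟨x, hx⟩
    · exact glue_fst_right ⟨x, hx⟩
  · ext x
    by_cases hi : i ∈ B
    · by_cases hx : x ∈ A
      · exact glue_snd_left_left ⟨i, hi⟩ ⟨x, hx⟩
      · refine (glue_snd_left_right ⟨i, hi⟩ ⟨x, hx⟩).trans ?_
        obtain ⟨y, hy, hne⟩ := (hB i).mp hi
        obtain ⟨a, b, -, hs⟩ := h2 i
        rw [hs] at hne ⊢
        have hA := hA2 i y
        rw [hs] at hA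
        rcases eq_or_ne y a with rfl | hya
        · rw [swap_apply_left] at hA
          rw [swap_apply_of_ne_of_ne] <;> rintro rfl
          · exact hx hy
          · exact hx (hA.mpr hy)
        · rcases eq_or_ne y b with rfl | hyb
          · rw [swap_apply_right] at hA
            rw [swap_apply_of_ne_of_ne] <;> rintro rfl
            · exact hx (hA.mpr hy)
            · exact hx hy
          · exact absurd (swap_apply_of_ne_of_ne hya hyb) hne
    · by_cases hx : x ∈ A
      · refine (glue_snd_right_left ⟨i, hi⟩ ⟨x, hx⟩).trans ?_
        by_contra hne
        exact hi ((hB i).mpr ⟨x, hx, fun h => hne h.symm⟩)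
      · exact glue_snd_right_right ⟨i, hi⟩ ⟨x, hx⟩

theorem card_fiber {x : X} (hx : x ∈ A) :
    Nat.card {C : Perm X × (I → Perm X) // IsCover r C.1 C.2 ∧ component C x = A ∧
      branchPoints C A = B} =
    connectedCount r {x // x ∈ A} {i // i ∈ B} * coverCount r {x // ¬ x ∈ A} {i // ¬ i ∈ B} := by
  rw [connectedCount, coverCount, ← Nat.card_prod]
  symm
  refine Nat.card_congr (Equiv.ofBijective (fun p => ⟨glue A B p.1.1 p.2.1,
    isCover_glue.mpr ⟨p.1.2.1, p.2.2⟩, (component_glue hx).mpr p.1.2.2,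
    branchPoints_glue p.1.2.1.simple⟩) ⟨?_, ?_⟩)
  · rintro ⟨⟨c₁, _⟩, ⟨c₁', _⟩⟩ ⟨⟨c₂, _⟩, ⟨c₂', _⟩⟩ h
    have := glue_injective (a₁ := (c₁, c₁')) (a₂ := (c₂, c₂')) (congrArg Subtype.val h)
    simp only [Prod.mk.injEq] at this
    simp only [this.1, this.2]
  · rintro ⟨C, hC, hcomp, hbr⟩
    obtain ⟨c, c', rfl⟩ := exists_glue (A := A) (B := B) C hC.simple
      (fun z => by
        have := fst_mem_component C x z
        rwa [hcomp] at this)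
      (fun i z => by
        have := snd_mem_component C x i z
        rwa [hcomp] at this)
      (fun i => by
        rw [← Finset.mem_coe, ← hbr]
        rfl)
    obtain ⟨h1, h2⟩ := isCover_glue.mp hC
    exact ⟨⟨⟨c, h1, (component_glue hx).mp hcomp⟩, ⟨c', h2⟩⟩, rfl⟩

variable [Fintype X] [Fintype I]

theorem coverCount_eq_sum (r : ℕ) (x : X) : coverCount r X I =
    ∑ A : Finset X, ∑ B : Finset I, if x ∈ A then connectedCount r {x // x ∈ A} {i // i ∈ B} *
      coverCount r {x // ¬ x ∈ A} {i // ¬ i ∈ B} else 0 := by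
  classical
  let key : {C : Perm X × (I → Perm X) // IsCover r C.1 C.2} → Finset X × Finset I := fun C =>
    ((component C.1 x).toFinset, (branchPoints C.1 (component C.1 x)).toFinset)
  rw [coverCount, ← Nat.card_congr (Equiv.sigmaFiberEquiv key), Nat.card_sigma,
    Fintype.sum_prod_type]
  refine Finset.sum_congr rfl fun A _ => Finset.sum_congr rfl fun B _ => ?_
  split_ifs with hx
  · rw [← card_fiber hx]
    refine Nat.card_congr ((Equiv.subtypeSubtypeEquivSubtypeInter _
      (fun C => ((component C x).toFinset, (branchPoints C (component C x)).toFinset) =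
        (A, B))).trans (Equiv.subtypeEquivRight fun C => ?_))
    refine and_congr_right fun _ => ?_
    rw [Prod.mk.injEq, ← Finset.coe_inj, ← Finset.coe_inj, Set.coe_toFinset, Set.coe_toFinset]
    constructor
    · rintro ⟨h1, h2⟩
      exact ⟨h1, by rw [← h1, h2]⟩
    · rintro ⟨h1, h2⟩
      exact ⟨h1, by rw [h1, h2]⟩
  · have : IsEmpty {C // key C = (A, B)} := ⟨fun ⟨C, hC⟩ => hx (by
      have := congrArg Prod.fst hC
      simp only [key] at this
      rw [← this, Set.mem_toFinset]
      exact mem_component_self C.1 x)⟩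
    exact Nat.card_of_isEmpty

end Glue

/-- Recursion for the number of coverings: the choice of a sheet singles out a connected
component. -/
theorem mul_coverCount (r d s : ℕ) : d * coverCount r (Fin d) (Fin s) =
    ∑ k ∈ Finset.range (d + 1), ∑ t ∈ Finset.range (s + 1), d.choose k * s.choose t *
      (k * connectedCount r (Fin k) (Fin t) * coverCount r (Fin (d - k)) (Fin (s - t))) := by
  -- The factor `d` is a choice of sheet. After exchanging sums, a component `A` is counted once for
  -- each of its sheets, which is the factor `k`.
  have h1 : d * coverCount r (Fin d) (Fin s) = ∑ _x : Fin d, coverCount r (Fin d) (Fin s) := by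
    simp
  rw [h1, Finset.sum_congr rfl fun x _ => coverCount_eq_sum (I := Fin s) r x, Finset.sum_comm]
  have h2 : ∀ A : Finset (Fin d), (∑ x : Fin d, ∑ B : Finset (Fin s),
      if x ∈ A then connectedCount r {x // x ∈ A} {i // i ∈ B} *
        coverCount r {x // ¬ x ∈ A} {i // ¬ i ∈ B} else 0) =
      (fun k => ∑ t ∈ Finset.range (s + 1), s.choose t *
      (k * connectedCount r (Fin k) (Fin t) * coverCount r (Fin (d - k)) (Fin (s - t)))) A.card := by
    intro A
    rw [Finset.sum_comm]
    have h3 : ∀ B : Finset (Fin s), (∑ x : Fin d,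
      if x ∈ A then connectedCount r {x // x ∈ A} {i // i ∈ B} *
        coverCount r {x // ¬ x ∈ A} {i // ¬ i ∈ B} else 0) =
        (fun t => A.card * connectedCount r (Fin A.card) (Fin t) *
          coverCount r (Fin (d - A.card)) (Fin (s - t))) B.card := by
      intro B
      have e1 : {x // x ∈ A} ≃ Fin A.card := A.equivFin
      have e2 : {i // i ∈ B} ≃ Fin B.card := B.equivFin
      have e3 : {x // ¬ x ∈ A} ≃ Fin (d - A.card) :=
        Fintype.equivFinOfCardEq (by rw [Fintype.card_subtype_compl]; simp)
      have e4 : {i // ¬ i ∈ B} ≃ Fin (s - B.card) :=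
        Fintype.equivFinOfCardEq (by rw [Fintype.card_subtype_compl]; simp)
      rw [Finset.sum_ite_mem, Finset.univ_inter, Finset.sum_const, smul_eq_mul,
        connectedCount_congr e1 e2, coverCount_congr e3 e4]
      ring
    rw [Finset.sum_congr rfl fun B _ => h3 B, ← Finset.powerset_univ]
    refine (Finset.sum_powerset_apply_card (fun t => A.card *
      connectedCount r (Fin A.card) (Fin t) *
        coverCount r (Fin (d - A.card)) (Fin (s - t)))).trans ?_
    simp
  rw [Finset.sum_congr rfl fun A _ => h2 A, ← Finset.powerset_univ]
  refine (Finset.sum_powerset_apply_card (fun k => ∑ t ∈ Finset.range (s + 1), s.choose t *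
      (k * connectedCount r (Fin k) (Fin t) *
        coverCount r (Fin (d - k)) (Fin (s - t))))).trans ?_
  rw [Finset.card_univ, Fintype.card_fin]
  refine Finset.sum_congr rfl fun k _ => ?_
  rw [smul_eq_mul, Finset.mul_sum]
  refine Finset.sum_congr rfl fun t _ => ?_
  ring

end

end OrbifoldHurwitz

namespace OrbifoldHurwitz

noncomputable section

open Equiv Equiv.Perm

/-! ### Counting coverings -/

theorem card_isSwap (d : ℕ) : Nat.card {τ : Perm (Fin d) // τ.IsSwap} = d.choose 2 := by
  rcases lt_or_ge d 2 with hd | hd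
  · have : IsEmpty {τ : Perm (Fin d) // τ.IsSwap} := ⟨fun ⟨_, a, b, hab, _⟩ => hab (by
      ext
      have := a.2
      have := b.2
      omega)⟩
    rw [Nat.card_of_isEmpty, Nat.choose_eq_zero_of_lt hd]
  · have := Equiv.Perm.card_of_cycleType_singleton (α := Fin d) le_rfl (by simpa using hd)
    rw [Nat.card_congr (Equiv.subtypeEquivRight fun τ : Perm (Fin d) => isSwap_iff_cycleType),
      Nat.card_eq_fintype_card, Fintype.card_subtype]
    simpa using this

/-- The number of permutations all of whose cycles have length `r`. -/
def zerosCount (r d : ℕ) : ℕ :=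
  Nat.card {α : Perm (Fin d) // ∀ x, Function.minimalPeriod α x = r}

theorem coverCount_eq (r d s : ℕ) :
    coverCount r (Fin d) (Fin s) = zerosCount r d * d.choose 2 ^ s := by
  have e : {c : Perm (Fin d) × (Fin s → Perm (Fin d)) // IsCover r c.1 c.2} ≃
      {α : Perm (Fin d) // ∀ x, Function.minimalPeriod α x = r} ×
        (Fin s → {τ : Perm (Fin d) // τ.IsSwap}) :=
    { toFun := fun c => (⟨c.1.1, c.2.zeros⟩, fun i => ⟨c.1.2 i, c.2.simple i⟩)
      invFun := fun p => ⟨(p.1.1, fun i => (p.2 i).1), ⟨p.1.2, fun i => (p.2 i).2⟩⟩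
      left_inv := fun _ => rfl
      right_inv := fun _ => rfl }
  rw [coverCount, Nat.card_congr e, Nat.card_prod, Nat.card_fun, card_isSwap, zerosCount,
    Nat.card_eq_fintype_card (α := Fin s), Fintype.card_fin]

theorem zerosCount_eq_zero {r d : ℕ} (h : ¬ r ∣ d) : zerosCount r d = 0 := by
  have : IsEmpty {α : Perm (Fin d) // ∀ x, Function.minimalPeriod α x = r} := ⟨fun ⟨α, hα⟩ => h
    ⟨_, by simpa using card_eq_mul_cycleCount hα⟩⟩
  exact Nat.card_of_isEmpty

theorem card_support_cycleOf {X : Type*} [Fintype X] [DecidableEq X] {σ : Perm X} {x : X}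
    (hx : x ∈ σ.support) : (σ.cycleOf x).support.card = Function.minimalPeriod σ x := by
  rw [← card_sameCycle, Nat.card_eq_fintype_card, ← Fintype.card_coe]
  refine Fintype.card_congr (Equiv.subtypeEquivRight fun y => ?_)
  rw [mem_support_cycleOf_iff, sameCycle_comm]
  simp [hx]

/-- The bound $r\ge2$ is needed because `cycleType` omits fixed points; the case $r=1$ is treated
separately in `zerosCount_mul`. -/
theorem minimalPeriod_eq_iff_cycleType {r m : ℕ} (hr : 2 ≤ r) {X : Type*} [Fintype X]
    [DecidableEq X] (hX : Fintype.card X = r * m) (σ : Perm X) :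
    (∀ x, Function.minimalPeriod σ x = r) ↔ σ.cycleType = Multiset.replicate m r := by
  constructor
  · intro h
    have hsupp : σ.support = Finset.univ := by
      refine Finset.eq_univ_iff_forall.mpr fun x => ?_
      rw [mem_support]
      intro hx
      have := Function.IsPeriodicPt.minimalPeriod_le one_pos (show Function.IsPeriodicPt σ 1 x from hx)
      rw [h] at this
      omega
    have hall : ∀ b ∈ σ.cycleType, b = r := fun b hb => by
      rw [cycleType_def, Multiset.mem_map] at hb
      obtain ⟨c, hc, rfl⟩ := hb
      have hc' : c ∈ σ.cycleFactorsFinset := hc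
      obtain ⟨x, hx⟩ := (mem_cycleFactorsFinset_iff.mp hc').1.nonempty_support
      rw [Function.comp_apply, cycle_is_cycleOf hx hc', card_support_cycleOf (by simp [hsupp]), h]
    have hrep := Multiset.eq_replicate_card.mpr hall
    have hsum := sum_cycleType σ
    rw [hsupp, Finset.card_univ, hX, hrep, Multiset.sum_replicate, smul_eq_mul, mul_comm] at hsum
    rw [hrep, Nat.eq_of_mul_eq_mul_left (by omega) hsum]
  · intro h x
    have hsum := sum_cycleType σ
    rw [h, Multiset.sum_replicate, smul_eq_mul, mul_comm, ← hX, eq_comm,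
      Finset.card_eq_iff_eq_univ] at hsum
    have hx : x ∈ σ.support := by simp [hsum]
    rw [← card_support_cycleOf hx]
    have : (σ.cycleOf x).support.card ∈ σ.cycleType := by
      rw [cycleType_def, Multiset.mem_map]
      exact ⟨_, cycleOf_mem_cycleFactorsFinset_iff.mpr hx, rfl⟩
    rw [h] at this
    exact Multiset.eq_of_mem_replicate this

theorem zerosCount_mul (r m : ℕ) (hr : 0 < r) :
    zerosCount r (r * m) * (r ^ m * m.factorial) = (r * m).factorial := by
  rcases Nat.lt_or_ge 1 r with h | h
  · have hcard := Equiv.Perm.card_of_cycleType_mul_eq (Fin (r * m)) (Multiset.replicate m r)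
    rw [if_pos ⟨by simp [mul_comm], fun a ha => by rw [Multiset.eq_of_mem_replicate ha]; exact h⟩,
      Fintype.card_fin, Multiset.sum_replicate, smul_eq_mul, mul_comm m r, Nat.sub_self,
      Nat.factorial_zero, one_mul, Multiset.prod_replicate] at hcard
    have hprod : ∏ n ∈ (Multiset.replicate m r).toFinset,
        ((Multiset.replicate m r).count n).factorial = m.factorial := by
      rcases Nat.eq_zero_or_pos m with rfl | hm
      · simp
      · rw [Multiset.toFinset_replicate, if_neg hm.ne', Finset.prod_singleton,
          Multiset.count_replicate_self]
    rw [hprod] at hcard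
    rw [← hcard, zerosCount, Nat.card_eq_fintype_card, Fintype.card_subtype]
    simp_rw [minimalPeriod_eq_iff_cycleType h (Fintype.card_fin (r * m))]
  · obtain rfl : r = 1 := by omega
    have : zerosCount 1 (1 * m) = 1 := by
      rw [zerosCount, Nat.card_eq_one_iff_unique]
      refine ⟨⟨fun α β => Subtype.ext (Equiv.ext fun x => ?_)⟩, ⟨1, fun x => ?_⟩⟩
      · have h1 := Function.minimalPeriod_eq_one_iff_isFixedPt.mp (α.2 x)
        have h2 := Function.minimalPeriod_eq_one_iff_isFixedPt.mp (β.2 x)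
        exact h1.trans h2.symm
      · exact Function.minimalPeriod_eq_one_iff_isFixedPt.mpr rfl
    rw [this]
    simp

theorem connectedCount_eq_zero_of_not_dvd {r d s : ℕ} (h : ¬ r ∣ d) :
    connectedCount r (Fin d) (Fin s) = 0 := by
  have : IsEmpty {c : Perm (Fin d) × (Fin s → Perm (Fin d)) //
      IsCover r c.1 c.2 ∧ IsConnectedCover c.1 c.2} := ⟨fun ⟨c, hc, _⟩ => h
    ⟨_, by simpa using card_eq_mul_cycleCount hc.zeros⟩⟩
  exact Nat.card_of_isEmpty

theorem cycleCount_of_isCover {r d s : ℕ} (hr : 0 < r) {α : Perm (Fin d)}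
    {τ : Fin s → Perm (Fin d)} (h : IsCover r α τ) : cycleCount α = d / r := by
  have := card_eq_mul_cycleCount h.zeros
  rw [Nat.card_eq_fintype_card, Fintype.card_fin] at this
  exact (Nat.div_eq_of_eq_mul_right hr this).symm

/-- There is at least one pole, so Riemann-Hurwitz gives $1+d/r\le s+2$. This is why $\hbar$ occurs
in $\log Z$ to no power below $-1$. -/
theorem connectedCount_eq_zero_of_lt {r d s : ℕ} (hr : 0 < r) (hd : 0 < d)
    (h : s + 1 < d / r) : connectedCount r (Fin d) (Fin s) = 0 := by
  have : Nonempty (Fin d) := ⟨⟨0, hd⟩⟩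
  have : IsEmpty {c : Perm (Fin d) × (Fin s → Perm (Fin d)) //
      IsCover r c.1 c.2 ∧ IsConnectedCover c.1 c.2} := ⟨fun ⟨c, hc, hconn⟩ => by
    have h1 := (cycleCount_add_le hc.simple hconn).1
    have h2 := cycleCount_pos (c.1 * (List.ofFn c.2).prod)
    rw [cycleCount_of_isCover hr hc] at h1
    omega⟩
  exact Nat.card_of_isEmpty

/-! ### Labelled poles -/

/-- `ℓ` labels the cycles of `σ`. -/
def IsLabelling {X : Type*} {n : ℕ} (σ : Perm X) (ℓ : X → Fin n) : Prop :=
  (∀ x y, ℓ x = ℓ y ↔ σ.SameCycle x y) ∧ Function.Surjective ℓ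

theorem card_isLabelling {X : Type*} [Finite X] (n : ℕ) (σ : Perm X) :
    Nat.card {ℓ : X → Fin n // IsLabelling σ ℓ} = if cycleCount σ = n then n.factorial else 0 := by
  have e : {ℓ : X → Fin n // IsLabelling σ ℓ} ≃ (Quotient (SameCycle.setoid σ) ≃ Fin n) :=
    { toFun := fun ℓ => Equiv.ofBijective
        (Quotient.lift ℓ.1 fun x y h => (ℓ.2.1 x y).mpr h) (by
          constructor
          · intro q q' h
            induction q using Quotient.inductionOn with | _ x
            induction q' using Quotient.inductionOn with | _ y
            exact Quotient.sound ((ℓ.2.1 x y).mp h)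
          · intro i
            obtain ⟨x, hx⟩ := ℓ.2.2 i
            exact ⟨Quotient.mk _ x, hx⟩)
      invFun := fun e => ⟨fun x => e (Quotient.mk _ x),
        fun x y => by rw [e.injective.eq_iff, Quotient.eq]; rfl,
        e.surjective.comp Quotient.mk_surjective⟩
      left_inv := fun _ => rfl
      right_inv := fun e => by
        ext q
        induction q using Quotient.inductionOn with | _ x
        rfl }
  rw [Nat.card_congr e]
  split_ifs with h
  · classical
    have := Fintype.ofFinite (Quotient (SameCycle.setoid σ))
    have hcard : Fintype.card (Quotient (SameCycle.setoid σ)) = n := by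
      rw [← h, cycleCount, Nat.card_eq_fintype_card]
    rw [Nat.card_eq_fintype_card, Fintype.card_equiv (Fintype.equivFinOfCardEq hcard), hcard]
  · have : IsEmpty (Quotient (SameCycle.setoid σ) ≃ Fin n) := ⟨fun e => h (by
      rw [cycleCount, Nat.card_congr e, Nat.card_eq_fintype_card, Fintype.card_fin])⟩
    exact Nat.card_of_isEmpty

/-- The number of connected coverings with `n` poles. -/
def polesCount (r d s n : ℕ) : ℕ :=
  Nat.card {c : Perm (Fin d) × (Fin s → Perm (Fin d)) //
    (IsCover r c.1 c.2 ∧ IsConnectedCover c.1 c.2) ∧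
      cycleCount (c.1 * (List.ofFn c.2).prod) = n}

/-- The number of connected coverings with labelled poles of orders `μ`. -/
def monodromyCount (r d s : ℕ) {n : ℕ} (μ : Fin n → ℕ) : ℕ :=
  Nat.card {c : Perm (Fin d) × (Fin s → Perm (Fin d)) × (Fin d → Fin n) //
    IsMonodromy r μ c.1 c.2.1 c.2.2}

theorem hurwitz_eq (r g : ℕ) {n : ℕ} (μ : Fin n → ℕ) : hurwitz r g μ =
    (monodromyCount r (∑ i, μ i) (simpleBranchPoints r g μ) μ : ℚ) /
      ((∑ i, μ i).factorial * (simpleBranchPoints r g μ).factorial) := rfl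

theorem card_labelled (r d s n : ℕ) :
    Nat.card {c : Perm (Fin d) × (Fin s → Perm (Fin d)) × (Fin d → Fin n) //
      (IsCover r c.1 c.2.1 ∧ IsConnectedCover c.1 c.2.1) ∧
        IsLabelling (c.1 * (List.ofFn c.2.1).prod) c.2.2} = n.factorial * polesCount r d s n := by
  classical
  have e : {c : Perm (Fin d) × (Fin s → Perm (Fin d)) × (Fin d → Fin n) //
      (IsCover r c.1 c.2.1 ∧ IsConnectedCover c.1 c.2.1) ∧
        IsLabelling (c.1 * (List.ofFn c.2.1).prod) c.2.2} ≃
      Σ c : {c : Perm (Fin d) × (Fin s → Perm (Fin d)) //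
        IsCover r c.1 c.2 ∧ IsConnectedCover c.1 c.2},
        {ℓ : Fin d → Fin n // IsLabelling (c.1.1 * (List.ofFn c.1.2).prod) ℓ} :=
    { toFun := fun c => ⟨⟨(c.1.1, c.1.2.1), c.2.1⟩, ⟨c.1.2.2, c.2.2⟩⟩
      invFun := fun p => ⟨(p.1.1.1, p.1.1.2, p.2.1), p.1.2, p.2.2⟩
      left_inv := fun _ => rfl
      right_inv := fun _ => rfl }
  rw [Nat.card_congr e, Nat.card_sigma]
  simp_rw [card_isLabelling]
  rw [Finset.sum_ite, Finset.sum_const_zero, add_zero, Finset.sum_const, smul_eq_mul, mul_comm,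
    polesCount, ← Fintype.card_subtype, ← Nat.card_eq_fintype_card]
  congr 1
  exact Nat.card_congr (Equiv.subtypeSubtypeEquivSubtypeInter
    (fun c : Perm (Fin d) × (Fin s → Perm (Fin d)) =>
      IsCover r c.1 c.2 ∧ IsConnectedCover c.1 c.2)
    (fun c => cycleCount (c.1 * (List.ofFn c.2).prod) = n))

theorem isMonodromy_iff {r n d s : ℕ} {μ : Fin n → ℕ} (hμ : ∀ i, 0 < μ i) {α : Perm (Fin d)}
    {τ : Fin s → Perm (Fin d)} {ℓ : Fin d → Fin n} : IsMonodromy r μ α τ ℓ ↔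
      ((IsCover r α τ ∧ IsConnectedCover α τ) ∧ IsLabelling (α * (List.ofFn τ).prod) ℓ) ∧
        (fun i => Nat.card {x // ℓ x = i}) = μ := by
  constructor
  · rintro ⟨h1, h2, h3, h4, h5⟩
    refine ⟨⟨⟨⟨h1, h2⟩, (isPretransitive_closure_iff α τ).mp h5⟩, h3, fun i => ?_⟩, funext h4⟩
    have : 0 < Nat.card {x // ℓ x = i} := by rw [h4]; exact hμ i
    obtain ⟨x, hx⟩ := (Nat.card_pos_iff.mp this).1
    exact ⟨x, hx⟩
  · rintro ⟨⟨⟨⟨h1, h2⟩, h5⟩, h3, -⟩, h4⟩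
    exact ⟨h1, h2, h3, congrFun h4, (isPretransitive_closure_iff α τ).mpr h5⟩

/-- Labelled coverings are sorted by their vector of pole orders. Vectors with a zero entry do not
occur, since a labelling is surjective. -/
theorem sum_monodromyCount (r d s n : ℕ) :
    ∑ μ ∈ Finset.finsuppAntidiag (Finset.univ : Finset (Fin n)) d,
      (if ∀ i, 0 < μ i then monodromyCount r d s μ else 0) = n.factorial * polesCount r d s n := by
  classical
  rw [← card_labelled, Nat.card_eq_fintype_card, Fintype.card_subtype]
  rw [Finset.card_eq_sum_card_fiberwise (f := fun c => Finsupp.equivFunOnFinite.symm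
    (fun i => Nat.card {x // c.2.2 x = i})) (t := Finset.finsuppAntidiag Finset.univ d)]
  · refine Finset.sum_congr rfl fun μ _ => ?_
    split_ifs with hμ
    · rw [monodromyCount, Nat.card_eq_fintype_card, Fintype.card_subtype, Finset.filter_filter]
      congr 1
      refine Finset.filter_congr fun c _ => ?_
      rw [isMonodromy_iff hμ, Equiv.symm_apply_eq]
      rfl
    · symm
      rw [Finset.card_eq_zero, Finset.filter_eq_empty_iff]
      intro c hc hcμ
      refine hμ fun i => ?_
      rw [Finset.mem_filter] at hc
      rw [← hcμ]
      obtain ⟨x, hx⟩ := hc.2.2.2 i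
      have : Nonempty {x // c.2.2 x = i} := ⟨⟨x, hx⟩⟩
      exact Nat.card_pos
  · intro c _
    rw [Finset.mem_coe, Finset.mem_finsuppAntidiag]
    refine ⟨?_, Finset.subset_univ _⟩
    simp only [Finsupp.equivFunOnFinite_symm_apply_apply]
    rw [← Nat.card_sigma, Nat.card_congr (Equiv.sigmaFiberEquiv c.2.2), Nat.card_eq_fintype_card,
      Fintype.card_fin]

/-- Every connected covering has a genus `g` and a number `n` of poles, and
`2g - 2 + n = s - d / r`. -/
theorem sum_polesCount {r d : ℕ} (hr : 0 < r) (hd : 0 < d) (m : ℕ) :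
    ∑ p ∈ (Finset.range (m + 2) ×ˢ Finset.Icc 1 (m + 1)).filter (fun p => 2 * p.1 + p.2 = m + 1),
      polesCount r d (m + 1 + d / r - 2) p.2 =
        connectedCount r (Fin d) (Fin (m + 1 + d / r - 2)) := by
  classical
  have : Nonempty (Fin d) := ⟨⟨0, hd⟩⟩
  set s := m + 1 + d / r - 2 with hs
  have key : ∀ c : Perm (Fin d) × (Fin s → Perm (Fin d)),
      IsCover r c.1 c.2 ∧ IsConnectedCover c.1 c.2 →
      ∃ g, 2 * g + cycleCount (c.1 * (List.ofFn c.2).prod) = m + 1 := fun c hc => by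
    obtain ⟨h1, h2⟩ := cycleCount_add_le hc.1.simple hc.2
    rw [cycleCount_of_isCover hr hc.1] at h1 h2
    have h3 : 0 < d / r := by rw [← cycleCount_of_isCover hr hc.1]; exact cycleCount_pos _
    obtain ⟨q, hq⟩ := h2
    -- The parity statement reads $n+d/r+s=2q$ with $s=m-1+d/r$, so $2g=m+1-n=2(m+d/r-q)$. Here
    -- $d/r>0$, so the natural subtraction defining `s` does not truncate.
    refine ⟨m + d / r - q, ?_⟩
    omega
  rw [connectedCount, Nat.card_eq_fintype_card, Fintype.card_subtype]
  rw [Finset.card_eq_sum_card_fiberwise (f := fun c : Perm (Fin d) × (Fin s → Perm (Fin d)) =>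
      ((m + 1 - cycleCount (c.1 * (List.ofFn c.2).prod)) / 2,
        cycleCount (c.1 * (List.ofFn c.2).prod)))
    (t := (Finset.range (m + 2) ×ˢ Finset.Icc 1 (m + 1)).filter
      (fun p => 2 * p.1 + p.2 = m + 1))]
  · refine Finset.sum_congr rfl fun p hp => ?_
    rw [polesCount, Nat.card_eq_fintype_card, Fintype.card_subtype, Finset.filter_filter]
    congr 1
    refine Finset.filter_congr fun c _ => and_congr_right fun _ => ?_
    rw [Finset.mem_filter] at hp
    constructor
    · intro h
      ext
      · change (m + 1 - cycleCount (c.1 * (List.ofFn c.2).prod)) / 2 = p.1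
        rw [h]
        omega
      · exact h
    · intro h
      exact congrArg Prod.snd h
  · intro c hc
    rw [Finset.mem_coe, Finset.mem_filter] at hc
    obtain ⟨g, hg⟩ := key c hc.2
    have := cycleCount_pos (c.1 * (List.ofFn c.2).prod)
    rw [Finset.mem_coe, Finset.mem_filter, Finset.mem_product, Finset.mem_range, Finset.mem_Icc]
    refine ⟨⟨?_, ?_, ?_⟩, ?_⟩ <;> simp only <;> omega

end

end OrbifoldHurwitz

namespace OrbifoldHurwitz

noncomputable section

open PowerSeries

/-! ### The free energies as series in `x` -/

theorem hasSubst_const_X (n : ℕ) :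
    MvPowerSeries.HasSubst (fun _ : Fin n => (X : PowerSeries ℂ)) :=
  MvPowerSeries.hasSubst_of_constantCoeff_zero fun _ => by
    change constantCoeff (X : PowerSeries ℂ) = 0
    simp

theorem coeff_subst_const_X {n : ℕ} (F : MvPowerSeries (Fin n) ℂ) (d : ℕ) :
    coeff d (MvPowerSeries.subst (fun _ : Fin n => (X : PowerSeries ℂ)) F : PowerSeries ℂ) =
      ∑ μ ∈ Finset.finsuppAntidiag Finset.univ d, MvPowerSeries.coeff μ F := by
  have h := MvPowerSeries.coeff_subst (hasSubst_const_X n) F (Finsupp.single () d)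
  have h' : ∀ μ : Fin n →₀ ℕ, MvPowerSeries.coeff (Finsupp.single () d)
      (μ.prod fun _ e => (X : PowerSeries ℂ) ^ e) = if d = ∑ i, μ i then 1 else 0 := fun μ => by
    rw [Finsupp.prod_fintype _ _ (fun _ => pow_zero _), Finset.prod_pow_eq_pow_sum]
    exact coeff_X_pow d _
  refine h.trans ?_
  simp_rw [h']
  rw [finsum_eq_sum_of_support_subset (s := Finset.finsuppAntidiag Finset.univ d)]
  · refine Finset.sum_congr rfl fun μ hμ => ?_
    rw [Finset.mem_finsuppAntidiag] at hμ
    rw [if_pos hμ.1.symm, smul_eq_mul, mul_one]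
  · intro μ hμ
    rw [Finset.mem_coe, Finset.mem_finsuppAntidiag]
    refine ⟨?_, Finset.subset_univ _⟩
    by_contra hne
    refine hμ ?_
    simp only
    rw [if_neg fun h => hne h.symm, smul_zero]

/-- Setting all $z_i$ equal commutes with the change of variables, so one may first set all $x_i$
equal to $x$. -/
theorem freeEnergyDiag_eq_subst (r g n : ℕ) : freeEnergyDiag r g n =
    PowerSeries.subst (lambertX r)
      (MvPowerSeries.subst (fun _ : Fin n => (X : PowerSeries ℂ)) (freeEnergyX r g n)) := by
  have hX := hasSubst_const_X n
  have hl : MvPowerSeries.HasSubst (fun i : Fin n =>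
      PowerSeries.subst (MvPowerSeries.X i : MvPowerSeries (Fin n) ℂ) (lambertX r)) :=
    MvPowerSeries.hasSubst_of_constantCoeff_zero fun i =>
      PowerSeries.constantCoeff_subst_eq_zero (MvPowerSeries.constantCoeff_X i) _
        (constantCoeff_lambertX r)
  have hlam := hasSubst_lambertX r
  rw [freeEnergyDiag, freeEnergy, MvPowerSeries.subst_comp_subst_apply hl hX, PowerSeries.subst,
    MvPowerSeries.subst_comp_subst_apply hX hlam.const]
  congr 1
  funext i
  have h1 : MvPowerSeries.HasSubst (fun _ : Unit => (MvPowerSeries.X i : MvPowerSeries (Fin n) ℂ)) :=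
    (PowerSeries.HasSubst.X i).const
  have h2 : MvPowerSeries.subst (fun _ : Unit => lambertX r) (X : PowerSeries ℂ) = lambertX r :=
    subst_X hlam
  rw [h2, PowerSeries.subst, MvPowerSeries.subst_comp_subst_apply h1 hX]
  simp_rw [MvPowerSeries.subst_X hX]
  exact X_subst (lambertX r)

theorem coeff_freeEnergyX_diag (r g n d : ℕ) :
    coeff d (MvPowerSeries.subst (fun _ : Fin n => (X : PowerSeries ℂ)) (freeEnergyX r g n) :
      PowerSeries ℂ) =
      n.factorial * polesCount r d (2 * g + n + d / r - 2) n /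
        (d.factorial * (2 * g + n + d / r - 2).factorial) := by
  have h : ∀ μ ∈ Finset.finsuppAntidiag (Finset.univ : Finset (Fin n)) d,
      MvPowerSeries.coeff μ (freeEnergyX r g n) =
        ((if ∀ i, 0 < μ i then monodromyCount r d (2 * g + n + d / r - 2) μ else 0 : ℕ) : ℂ) /
        (d.factorial * (2 * g + n + d / r - 2).factorial) := fun μ hμ => by
    rw [Finset.mem_finsuppAntidiag] at hμ
    change (if ∀ i, 0 < μ i then (hurwitz r g μ : ℂ) else 0) = _
    split_ifs
    · rw [hurwitz_eq, simpleBranchPoints, hμ.1]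
      push_cast
      rfl
    · simp
  rw [coeff_subst_const_X, Finset.sum_congr rfl h, ← Finset.sum_div, ← Nat.cast_sum,
    sum_monodromyCount]
  push_cast
  rfl

/-- The series `S_m` in the variable `x`. -/
def connectedSeries (r m : ℕ) : PowerSeries ℂ :=
  .mk fun d => if d = 0 then 0 else
    connectedCount r (Fin d) (Fin (m + 1 + d / r - 2)) /
      (d.factorial * (m + 1 + d / r - 2).factorial)

theorem polesCount_zero_degree (r s : ℕ) {n : ℕ} (hn : 0 < n) : polesCount r 0 s n = 0 := by
  have : IsEmpty {c : Equiv.Perm (Fin 0) × (Fin s → Equiv.Perm (Fin 0)) //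
      (IsCover r c.1 c.2 ∧ IsConnectedCover c.1 c.2) ∧
      cycleCount (c.1 * (List.ofFn c.2).prod) = n} := ⟨fun ⟨c, _, hc⟩ => by
    have : IsEmpty (Quotient (Equiv.Perm.SameCycle.setoid (c.1 * (List.ofFn c.2).prod))) :=
      ⟨fun q => Quotient.inductionOn q fun x => x.elim0⟩
    rw [cycleCount, Nat.card_of_isEmpty] at hc
    omega⟩
  exact Nat.card_of_isEmpty

theorem freeEnergyS_eq_subst {r : ℕ} (hr : 0 < r) (m : ℕ) :
    freeEnergyS r m = (connectedSeries r m).subst (lambertX r) := by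
  have hs := hasSubst_lambertX r
  have h : connectedSeries r m =
      ∑ p ∈ (Finset.range (m + 2) ×ˢ Finset.Icc 1 (m + 1)).filter
        (fun p => 2 * p.1 + p.2 = m + 1), ((p.2.factorial : ℂ)⁻¹) •
        (MvPowerSeries.subst (fun _ : Fin p.2 => (X : PowerSeries ℂ)) (freeEnergyX r p.1 p.2) :
          PowerSeries ℂ) := by
    ext d
    rw [map_sum, connectedSeries, coeff_mk]
    have h1 : ∀ p ∈ (Finset.range (m + 2) ×ˢ Finset.Icc 1 (m + 1)).filter
        (fun p => 2 * p.1 + p.2 = m + 1), coeff d (((p.2.factorial : ℂ)⁻¹) •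
        (MvPowerSeries.subst (fun _ : Fin p.2 => (X : PowerSeries ℂ)) (freeEnergyX r p.1 p.2) :
          PowerSeries ℂ)) = (polesCount r d (m + 1 + d / r - 2) p.2 : ℂ) /
            (d.factorial * (m + 1 + d / r - 2).factorial) := fun p hp => by
      rw [Finset.mem_filter] at hp
      rw [coeff_smul, coeff_freeEnergyX_diag, hp.2, smul_eq_mul]
      have : (p.2.factorial : ℂ) ≠ 0 := Nat.cast_ne_zero.mpr (Nat.factorial_ne_zero _)
      field_simp
    rw [Finset.sum_congr rfl h1, ← Finset.sum_div, ← Nat.cast_sum]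
    -- Degree $0$ is separate: the empty covering satisfies `IsConnectedCover` vacuously, yet it has
    -- no poles and must not contribute.
    split_ifs with hd
    · subst hd
      rw [Finset.sum_eq_zero fun p hp => ?_]
      · simp
      · rw [Finset.mem_filter, Finset.mem_product, Finset.mem_Icc] at hp
        exact polesCount_zero_degree _ _ hp.1.2.1
    · rw [sum_polesCount hr (Nat.pos_of_ne_zero hd)]
  rw [h, freeEnergyS, ← coe_substAlgHom hs, map_sum]
  refine Finset.sum_congr rfl fun p _ => ?_
  rw [map_smul, coe_substAlgHom hs, freeEnergyDiag_eq_subst]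

theorem phase_subst {a : PowerSeries ℂ} (ha : constantCoeff a = 0) (G : ℕ → PowerSeries ℂ) :
    phase (fun m => (G m).subst a) = (phase G).subst (emb a) := by
  ext1 d
  rw [coeff_subst_emb ha, phase, coeff_mk]
  simp_rw [phase, coeff_mk, mul_assoc]
  rw [← Finset.mul_sum]
  congr 1
  have h : (PowerSeries.mk fun m => coeff d ((G m).subst a)) =
      ∑ k ∈ Finset.range (d + 1), (PowerSeries.mk fun m => coeff k (G m)) *
        C (coeff d (a ^ k)) := by
    ext m
    rw [coeff_mk, coeff_subst_eq_sum ha, map_sum]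
    refine Finset.sum_congr rfl fun k _ => ?_
    rw [coeff_mul_C, coeff_mk]
  rw [h, map_sum]
  refine Finset.sum_congr rfl fun k _ => ?_
  rw [map_mul, HahnSeries.ofPowerSeries_C]

/-! ### The exponential formula -/

/-- The exponential generating function, in the number of simple branch points, of
coverings of degree `d`. -/
def coverGF (r d : ℕ) : PowerSeries ℂ :=
  .mk fun s => coverCount r (Fin d) (Fin s) / (d.factorial * s.factorial)

/-- The exponential generating function, in the number of simple branch points, of
connected coverings of degree `d`. -/
def connectedGF (r d : ℕ) : PowerSeries ℂ :=
  .mk fun s => connectedCount r (Fin d) (Fin s) / (d.factorial * s.factorial)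

/-- The recursion by components becomes $xZ'=(xF')Z$: the binomial coefficients are absorbed by the
factorials of both exponential normalisations. -/
theorem natCast_mul_coverGF (r d : ℕ) : (d : PowerSeries ℂ) * coverGF r d =
    ∑ p ∈ Finset.HasAntidiagonal.antidiagonal d,
      (p.1 : PowerSeries ℂ) * connectedGF r p.1 * coverGF r p.2 := by
  have hC : ∀ (k : ℕ) (f : PowerSeries ℂ) s, coeff s ((k : PowerSeries ℂ) * f) = k * coeff s f :=
    fun k f s => by rw [← map_natCast (C : ℂ →+* PowerSeries ℂ) k, coeff_C_mul]
  ext s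
  have h := mul_coverCount r d s
  rw [hC, coverGF, coeff_mk, map_sum, ← mul_div_assoc, ← Nat.cast_mul, h,
    Finset.Nat.sum_antidiagonal_eq_sum_range_succ_mk]
  push_cast
  rw [Finset.sum_div]
  refine Finset.sum_congr rfl fun k hk => ?_
  rw [mul_assoc, hC, coeff_mul, Finset.Nat.sum_antidiagonal_eq_sum_range_succ_mk, Finset.sum_div,
    Finset.mul_sum]
  refine Finset.sum_congr rfl fun t ht => ?_
  rw [Finset.mem_range, Nat.lt_succ_iff] at hk ht
  simp only [connectedGF, coverGF, coeff_mk]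
  rw [Nat.cast_choose ℂ hk, Nat.cast_choose ℂ ht]
  have hf : ∀ q : ℕ, (q.factorial : ℂ) ≠ 0 := fun q => Nat.cast_ne_zero.mpr (Nat.factorial_ne_zero q)
  have := hf d
  have := hf s
  have := hf k
  have := hf t
  have := hf (d - k)
  have := hf (s - t)
  field_simp

theorem connectedGF_eq_zero {r d : ℕ} (h : ¬ r ∣ d) : connectedGF r d = 0 := by
  ext s
  simp [connectedGF, connectedCount_eq_zero_of_not_dvd h]

theorem coverGF_eq_zero {r d : ℕ} (h : ¬ r ∣ d) : coverGF r d = 0 := by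
  ext s
  simp [coverGF, coverCount_eq, zerosCount_eq_zero h]

theorem coverGF_mul {r : ℕ} (hr : 0 < r) (m : ℕ) : coverGF r (r * m) =
    C ((r : ℂ) ^ m * m.factorial)⁻¹ * rescale ((r * m).choose 2 : ℂ) (exp ℂ) := by
  ext s
  have h := zerosCount_mul r m hr
  have h' : (zerosCount r (r * m) : ℂ) * ((r : ℂ) ^ m * m.factorial) = (r * m).factorial := by
    exact_mod_cast h
  rw [coverGF, coeff_mk, coeff_C_mul, coeff_rescale, coeff_exp, coverCount_eq, ← h']
  have h1 : (r : ℂ) ≠ 0 := Nat.cast_ne_zero.mpr hr.ne'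
  have hf : ∀ q : ℕ, (q.factorial : ℂ) ≠ 0 := fun q => Nat.cast_ne_zero.mpr (Nat.factorial_ne_zero q)
  have h2 := hf m
  have h3 := hf s
  have h4 : (zerosCount r (r * m) : ℂ) ≠ 0 := fun h0 => hf (r * m) (by rw [← h', h0, zero_mul])
  push_cast
  simp only [one_div]
  field_simp

/-- `ħ^{-a}`. -/
def hbarInvPow (a : ℕ) : LaurentSeries ℂ := HahnSeries.single (-(a : ℤ)) 1

theorem hbarInvPow_add (a b : ℕ) : hbarInvPow (a + b) = hbarInvPow a * hbarInvPow b := by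
  rw [hbarInvPow, hbarInvPow, hbarInvPow, HahnSeries.single_mul_single, one_mul,
    show -(a : ℤ) + -(b : ℤ) = -((a + b : ℕ) : ℤ) by push_cast; ring]

/-- The partition function in the variable `x`. -/
def partitionX (r : ℕ) : Fun :=
  .mk fun d => hbarInvPow (d / r) * HahnSeries.ofPowerSeries ℤ ℂ (coverGF r d)

theorem coeff_phase_connectedSeries {r : ℕ} (hr : 0 < r) {d : ℕ} (hd : 0 < d) :
    coeff d (phase (connectedSeries r)) =
      hbarInvPow (d / r) * HahnSeries.ofPowerSeries ℤ ℂ (connectedGF r d) := by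
  by_cases hdvd : r ∣ d
  · have h1 : 1 ≤ d / r := Nat.div_pos (Nat.le_of_dvd hd hdvd) hr
    ext j
    rw [phase, coeff_mk, hbarInvPow, coeff_single_mul, coeff_single_mul, sub_neg_eq_add,
      sub_neg_eq_add]
    -- The two indexings of powers of $\hbar$ agree through $m-1=s-d/r$. Below $\hbar^{-1}$ only the
    -- right side could contribute, and there no connected coverings exist.
    rcases lt_or_ge (j + 1) 0 with hj | hj
    · rw [ofPowerSeries_coeff_of_neg _ hj]
      rcases lt_or_ge (j + (d / r : ℕ)) 0 with hj' | hj'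
      · rw [ofPowerSeries_coeff_of_neg _ hj']
      · obtain ⟨s, hs⟩ := Int.eq_ofNat_of_zero_le hj'
        rw [hs, ofPowerSeries_coeff_natCast, connectedGF, coeff_mk,
          connectedCount_eq_zero_of_lt hr hd (by omega)]
        simp
    · obtain ⟨m, hm⟩ := Int.eq_ofNat_of_zero_le hj
      have hs : j + (d / r : ℕ) = (m + 1 + d / r - 2 : ℕ) := by omega
      rw [hm, hs, ofPowerSeries_coeff_natCast, ofPowerSeries_coeff_natCast, coeff_mk,
        connectedSeries, connectedGF, coeff_mk, coeff_mk, if_neg hd.ne']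
  · have h0 : (PowerSeries.mk fun m => coeff d (connectedSeries r m)) = 0 := by
      ext m
      simp [connectedSeries, connectedCount_eq_zero_of_not_dvd hdvd]
    rw [connectedGF_eq_zero hdvd, phase, coeff_mk, h0, map_zero, mul_zero, mul_zero]

theorem constantCoeff_connectedSeries (r m : ℕ) : constantCoeff (connectedSeries r m) = 0 := by
  rw [← coeff_zero_eq_constantCoeff_apply, connectedSeries, coeff_mk, if_pos rfl]

theorem coverGF_zero {r : ℕ} (hr : 0 < r) : coverGF r 0 = 1 := by
  have := coverGF_mul hr 0
  simpa using this

/-- Both sides have constant term $1$ and solve $Z'=F'Z$. -/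
theorem fexp_phase_connectedSeries {r : ℕ} (hr : 0 < r) :
    fexp (phase (connectedSeries r)) = partitionX r := by
  have h0 := constantCoeff_phase (constantCoeff_connectedSeries r)
  refine eq_of_derivative_eq_mul (h := derivative _ (phase (connectedSeries r)))
    (derivative_fexp h0) ?_ ?_
  · apply X_mul_cancel
    rw [← mul_assoc]
    change eulerX _ = eulerX _ * _
    ext1 d
    have hcast : ∀ k : ℕ, (k : LaurentSeries ℂ) =
        HahnSeries.ofPowerSeries ℤ ℂ (k : PowerSeries ℂ) := fun k => (map_natCast _ k).symm
    rw [coeff_eulerX, coeff_mul, partitionX, coeff_mk, hcast, mul_left_comm, ← map_mul,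
      natCast_mul_coverGF, map_sum, Finset.mul_sum]
    refine Finset.sum_congr rfl fun p hp => ?_
    rw [Finset.HasAntidiagonal.mem_antidiagonal] at hp
    rw [coeff_eulerX, coeff_mk]
    rcases Nat.eq_zero_or_pos p.1 with h1 | h1
    · rw [h1]
      simp
    · rw [coeff_phase_connectedSeries hr h1, map_mul, map_mul, ← hcast]
      -- The exponent $d/r$ is additive when `r` divides the degree of the component; other degrees
      -- carry no coverings.
      by_cases hdvd : r ∣ p.1
      · rw [← hp, Nat.add_div_of_dvd_right hdvd, hbarInvPow_add]
        ring
      · rw [connectedGF_eq_zero hdvd]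
        simp
  · rw [constantCoeff_fexp h0, ← coeff_zero_eq_constantCoeff_apply, partitionX, coeff_mk,
      coverGF_zero hr, Nat.zero_div, map_one, mul_one]
    rfl

theorem partitionFunction_eq_subst {r : ℕ} (hr : 0 < r) :
    partitionFunction r = (partitionX r).subst (emb (lambertX r)) := by
  have h : freeEnergyS r = fun m => (connectedSeries r m).subst (lambertX r) :=
    funext (freeEnergyS_eq_subst hr)
  rw [partitionFunction, h, phase_subst (constantCoeff_lambertX r),
    ← subst_fexp (constantCoeff_emb_lambertX r)
      (constantCoeff_phase (constantCoeff_connectedSeries r)), fexp_phase_connectedSeries hr]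

/-! ### The quantum curve equations -/

theorem coeff_partitionX_mul {r : ℕ} (hr : 0 < r) (m : ℕ) : coeff (r * m) (partitionX r) =
    HahnSeries.C ((r : ℂ) ^ m * m.factorial)⁻¹ * hbarInvPow m *
      expHbar (r * m * (r * m - 1) / 2) := by
  rw [partitionX, coeff_mk, coverGF_mul hr, Nat.mul_div_cancel_left _ hr, map_mul,
    HahnSeries.ofPowerSeries_C, Nat.cast_choose_two, expHbar]
  push_cast
  ring

theorem coeff_partitionX_eq_zero {r d : ℕ} (h : ¬ r ∣ d) : coeff d (partitionX r) = 0 := by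
  rw [partitionX, coeff_mk, coverGF_eq_zero h, map_zero, mul_zero]

theorem hbar_mul_hbarInvPow_succ (m : ℕ) : hbar * hbarInvPow (m + 1) = hbarInvPow m := by
  rw [hbar, hbarInvPow, hbarInvPow, HahnSeries.single_mul_single, one_mul,
    show 1 + -((m + 1 : ℕ) : ℤ) = -(m : ℤ) by push_cast; ring]

theorem eulerHbar_hbarInvPow (m : ℕ) :
    eulerHbar (hbarInvPow m) = -(m : LaurentSeries ℂ) * hbarInvPow m := by
  have : -(m : LaurentSeries ℂ) = HahnSeries.C (-(m : ℂ)) := by rw [map_neg, map_natCast]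
  ext j
  rw [this, mul_comm, coeff_mul_laurent_C, coeff_eulerHbar, hbarInvPow, HahnSeries.coeff_single]
  split_ifs with h
  · simp [h]
  · simp

/-- Passing from $x^{rm}$ to $x^{r(m+1)}$ divides the coefficient by $\hbar\,r(m+1)$ and raises
$\binom{rm}2$ to $\binom{r(m+1)}2$; $P$ expresses exactly this ratio. -/
theorem opPX_partitionX {r : ℕ} (hr : 0 < r) : opPX r (partitionX r) = 0 := by
  ext1 d
  rw [coeff_opPX, map_zero]
  by_cases hdvd : r ∣ d
  · obtain ⟨m, rfl⟩ := hdvd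
    cases m with
    | zero => simp [hr.ne']
    | succ m =>
      have hle : r ≤ r * (m + 1) := Nat.le_mul_of_pos_right r (Nat.succ_pos m)
      have hsub : r * (m + 1) - r = r * m := by rw [Nat.mul_succ, Nat.add_sub_cancel]
      rw [if_pos hle, hsub, coeff_partitionX_mul hr, coeff_partitionX_mul hr]
      have hr' : (r : ℂ) ≠ 0 := Nat.cast_ne_zero.mpr hr.ne'
      have hm : (m : ℂ) + 1 ≠ 0 := Nat.cast_add_one_ne_zero m
      have hf : (m.factorial : ℂ) ≠ 0 := Nat.cast_ne_zero.mpr (Nat.factorial_ne_zero m)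
      have e1 : (r : ℂ) * ((m + 1 : ℕ) : ℂ) * ((r : ℂ) * ((m + 1 : ℕ) : ℂ) - 1) / 2 =
          ((r : ℂ) * ((r : ℂ) - 1) / 2 + ((r * m : ℕ) : ℂ) * r) +
            (r : ℂ) * m * ((r : ℂ) * m - 1) / 2 := by
        push_cast
        ring
      have e2 : (HahnSeries.C ((r : ℂ) ^ m * m.factorial)⁻¹ : LaurentSeries ℂ) =
          ((r * (m + 1) : ℕ) : LaurentSeries ℂ) *
            HahnSeries.C ((r : ℂ) ^ (m + 1) * (m + 1).factorial)⁻¹ := by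
        rw [← map_natCast (HahnSeries.C : ℂ →+* LaurentSeries ℂ), ← map_mul, Nat.factorial_succ]
        congr 1
        push_cast
        field_simp
        rw [pow_succ]
      rw [e1, expHbar_add, e2, ← hbar_mul_hbarInvPow_succ m]
      ring
  · rw [coeff_partitionX_eq_zero hdvd]
    split_ifs with h
    · rw [coeff_partitionX_eq_zero fun h' => hdvd ((Nat.dvd_sub_iff_left h dvd_rfl).mp h')]
      simp
    · simp

/-- The logarithmic $\hbar\partial_\hbar$-derivative of the coefficient of $x^{rm}$ is
$-m+\hbar\binom{rm}2$, which is the diagonal part of $Q$ at degree $rm$. -/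
theorem opQX_partitionX {r : ℕ} (hr : 0 < r) : opQX r (partitionX r) = 0 := by
  ext1 d
  rw [coeff_opQX, map_zero]
  by_cases hdvd : r ∣ d
  · obtain ⟨m, rfl⟩ := hdvd
    rw [coeff_partitionX_mul hr, eulerHbar_mul, eulerHbar_mul, eulerHbar_C, eulerHbar_expHbar,
      eulerHbar_hbarInvPow]
    have e1 : (HahnSeries.C ((r : ℂ) * m * (r * m - 1) / 2) : LaurentSeries ℂ) =
        HahnSeries.C (1 / 2 : ℂ) * (((r * m : ℕ) : LaurentSeries ℂ) *
          (((r * m : ℕ) : LaurentSeries ℂ) - 1)) := by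
      rw [show ((r : ℂ) * m * (r * m - 1) / 2) = 1 / 2 * (((r * m : ℕ) : ℂ) *
        (((r * m : ℕ) : ℂ) - 1)) by push_cast; ring]
      simp only [map_mul, map_sub, map_natCast, map_one]
    have e3 : (HahnSeries.C (1 / (r : ℂ)) : LaurentSeries ℂ) * r = 1 := by
      rw [← map_natCast (HahnSeries.C : ℂ →+* LaurentSeries ℂ) r, ← map_mul,
        one_div_mul_cancel (Nat.cast_ne_zero.mpr hr.ne'), map_one]
    rw [e1]
    push_cast
    set E := expHbar ((r : ℂ) * m * (r * m - 1) / 2)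
    linear_combination (-HahnSeries.C ((r : ℂ) ^ m * m.factorial)⁻¹ * hbarInvPow m * E * m) * e3
  · rw [coeff_partitionX_eq_zero hdvd]
    simp

theorem opP_partitionFunction {r : ℕ} (hr : 0 < r) : opP r (partitionFunction r) = 0 := by
  rw [partitionFunction_eq_subst hr, opP_subst hr, opPX_partitionX hr,
    ← coe_substAlgHom (hasSubst_emb_lambertX r), map_zero]

theorem opQ_partitionFunction {r : ℕ} (hr : 0 < r) : opQ r (partitionFunction r) = 0 := by
  rw [partitionFunction_eq_subst hr, opQ_subst hr, opQX_partitionX hr,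
    ← coe_substAlgHom (hasSubst_emb_lambertX r), map_zero]

theorem constantCoeff_freeEnergyS {r : ℕ} (hr : 0 < r) (m : ℕ) :
    constantCoeff (freeEnergyS r m) = 0 := by
  rw [freeEnergyS_eq_subst hr, constantCoeff_subst_of_zero (constantCoeff_lambertX r),
    constantCoeff_connectedSeries]

theorem freeEnergyS_zero (r : ℕ) : freeEnergyS r 0 = freeEnergyDiag r 0 1 := by
  have : (Finset.range (0 + 2) ×ˢ Finset.Icc 1 (0 + 1)).filter
      (fun p : ℕ × ℕ => 2 * p.1 + p.2 = 0 + 1) = {(0, 1)} := by decide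
  rw [freeEnergyS, this, Finset.sum_singleton]
  simp

/-- Since $PZ=0$, the leading term of $Z^{-1}PZ$ is zero. This places $DF_{0,1}$ on the curve, where
$z^r$ is the only solution without constant term. -/
theorem opD_freeEnergyDiag {r : ℕ} (hr : 0 < r) : opD r ℂ (freeEnergyDiag r 0 1) = X ^ r := by
  rw [← freeEnergyS_zero, ← onLambertCurve_iff hr]
  refine ⟨(semiclassical_P_iff _).mp ?_, constantCoeff_opD _⟩
  have h := semiclassicalLimit_opP hr (freeEnergyS r) (constantCoeff_freeEnergyS hr)
  have hP : opP r (fexp (phase (freeEnergyS r))) = 0 := opP_partitionFunction hr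
  rw [hP, mul_zero] at h
  exact h.unique (HasLeadingTerm.zero 0)

end

end OrbifoldHurwitz

open OrbifoldHurwitz in
theorem theorem1p2 (r : ℕ) (hr : 0 < r) :
    -- the two differential equations
    opP r (partitionFunction r) = 0 ∧
    opQ r (partitionFunction r) = 0 ∧
    -- `D = x ∂/∂x`
    (∀ f : Fun, opD r (LaurentSeries ℂ) (PowerSeries.subst (emb (lambertX r)) f) =
      PowerSeries.subst (emb (lambertX r))
        (PowerSeries.X * PowerSeries.derivative (LaurentSeries ℂ) f)) ∧
    -- the commutator relation
    opP r * opQ r - opQ r * opP r = opP r ∧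
    -- the semi-classical limit of the first equation, and the curve it recovers
    IsSemiclassicalLimit (opP r) 0 (fun S =>
      opD r ℂ S - lambertX r ^ r * fexp (PowerSeries.C (r : ℂ) * opD r ℂ S)) ∧
    (∀ S : PowerSeries ℂ, PowerSeries.constantCoeff S = 0 →
      (opD r ℂ S - lambertX r ^ r * fexp (PowerSeries.C (r : ℂ) * opD r ℂ S) = 0 ↔
        OnLambertCurve r (opD r ℂ S))) ∧
    -- the semi-classical limit of the second equation, and the curve it recovers
    IsSemiclassicalLimit (opQ r) (-1) (fun S =>
      (1 / 2 : ℂ) • opD r ℂ S ^ 2 - (1 / (r : ℂ)) • opD r ℂ S + S) ∧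
    (∀ S : PowerSeries ℂ, PowerSeries.constantCoeff S = 0 →
      ((1 / 2 : ℂ) • opD r ℂ S ^ 2 - (1 / (r : ℂ)) • opD r ℂ S + S = 0 ↔
        ∃ c : ℂ, c • lambertX r ^ r =
          opD r ℂ S * fexp (-(PowerSeries.C (r : ℂ) * opD r ℂ S)))) ∧
    (∀ S : PowerSeries ℂ, PowerSeries.constantCoeff S = 0 →
      ((1 / 2 : ℂ) • opD r ℂ S ^ 2 - (1 / (r : ℂ)) • opD r ℂ S + S = 0 ∧
          PowerSeries.coeff r S = 1 / (r : ℂ) ↔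
        OnLambertCurve r (opD r ℂ S))) ∧
    -- the leading term `S₀ = F_{0,1}` of the partition function gives the curve `y = z^r`
    freeEnergyS r 0 = freeEnergyDiag r 0 1 ∧
    PowerSeries.constantCoeff (freeEnergyDiag r 0 1) = 0 ∧
    PowerSeries.coeff r (freeEnergyDiag r 0 1) = 1 / (r : ℂ) ∧
    opD r ℂ (freeEnergyDiag r 0 1) = PowerSeries.X ^ r ∧
    (∀ y : PowerSeries ℂ, OnLambertCurve r y ∧ PowerSeries.constantCoeff y = 0 ↔
      y = PowerSeries.X ^ r) := by
  refine ⟨opP_partitionFunction hr, opQ_partitionFunction hr, opD_subst_emb_lambertX hr,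
    commutator hr, semiclassicalLimit_opP hr, fun S _ => semiclassical_P_iff S,
    semiclassicalLimit_opQ r, fun S hS => semiclassical_Q_iff hr hS,
    fun S hS => semiclassical_Q_normalized_iff hr hS, freeEnergyS_zero r, ?_, ?_,
    opD_freeEnergyDiag hr, onLambertCurve_iff hr⟩
  · rw [← freeEnergyS_zero, constantCoeff_freeEnergyS hr]
  · have h := coeff_opD (r := r) (freeEnergyDiag r 0 1)
    rw [opD_freeEnergyDiag hr, PowerSeries.coeff_X_pow_self] at h
    rw [eq_div_iff (Nat.cast_ne_zero.mpr hr.ne'), mul_comm, ← h]
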